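/- **Span programs.** Let $n\in\mathbb N$. A span program $P$ on $n$ bits consists of a target vector $t$ in a finite-dimensional complex inner product space $V$ and input vectors $v_i\in V$, $i\in I$, where the finite index set is a disjoint union $I=I_{\mathrm{free}}\sqcup\bigsqcup_{j\in[n],\,b\in\{0,1\}}I_{j,b}$. For $x\in\{0,1\}^n$ put $I(x)=I_{\mathrm{free}}\cup\bigcup_j I_{j,x_j}$; then $f_P(x)=1$ if $t\in\operatorname{span}\{v_i:i\in I(x)\}$, and $f_P(x)=0$ otherwise. Let $A:\mathbb C^I\to V$, $A w=\sum_i w_i v_i$, and let $\Pi(x)$ be the coordinate projection of $\mathbb C^I$ onto $\mathbb C^{I(x)}$. For costs $s\in[0,\infty)^n$ let $S$ be the diagonal operator on $\mathbb C^I$ with entry $\sqrt{s_j}$ at $i\in I_{j,b}$ and $0$ at $i\in I_{\mathrm{free}}$. The witness size of $P$ on $x$ is $$\mathrm{wsize}_s(P,x)=\begin{cases}\min\{\|Sw\|^2: w\in\mathbb C^I,\ A\Pi(x)w=t\}&\text{if } f_P(x)=1,\\ \min\{\|SA^\dagger w'\|^2: w'\in V,\ \langle t,w'\rangle=1,\ \Pi(x)A^\dagger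 w'=0\}&\text{if } f_P(x)=0,\end{cases}$$ and for $D\subseteq\{0,1\}^n$, $\mathrm{wsize}_s(P,D)=\max_{x\in D}\mathrm{wsize}_s(P,x)$. The program $P$ is canonical if $I_{\mathrm{free}}=\emptyset$, $V=\mathbb C^{F_0(P)}$ with $F_0(P)=\{x\in\{0,1\}^n:f_P(x)=0\}$, $t=\sum_{x\in F_0(P)}|x\rangle$, and $\langle x|v_i\rangle=0$ for all $x\in F_0(P)$, $j\in[n]$, $i\in I_{j,x_j}$. A canonical program is called real here if all coordinates $\langle x|v_i\rangle$ are real. **General adversary bound.** Let $f:D\to\{0,1\}$ with $D\subseteq\{0,1\}^n$. An adversary matrix for $f$ is a nonzero real symmetric $D\times D$ matrix $\Gamma$ with $\Gamma_{xy}=0$ whenever $f(x)=f(y)$. Then $$\mathrm{ADV}^{\pm}_s(f)=\max\{\|\Gamma\|:\ \Gamma\text{ an adversary matrix for } f,\ \|\Gamma\circ\Delta_j\|\le s_j\text{ for all }j\in[n]\},$$ where norms are operator norms, $\circ$ is the entrywise product, and $(\Delta_j)_{xy}$ is $1$ if $x_j\ne y_j$ and $0$ otherwise. A maximum over the empty set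 is $0$. **Semi-definite program.** Consider the program: minimize $\max_{x\in D}\sum_{j}s_jX_{(x,j),(x,j)}$ over real positive semi-definite matrices $X$ with rows and columns indexed by $D\times[n]$, subject to $\sum_{j:\,x_j\ne y_j}X_{(x,j),(y,j)}=1$ for all $x,y\in D$ with $f(x)\ne f(y)$. A Cholesky factorization of $X$ consists of an $m\in\mathbb N$ and vectors $c_{x,j}\in\mathbb R^m$ ($x\in D$, $j\in[n]$) with $X_{(x,j),(y,k)}=\langle c_{x,j},c_{y,k}\rangle$ for all $x,y,j,k$. **Theorem.** For every $n$, every $D\subseteq\{0,1\}^n$, every $f:D\to\{0,1\}$ and every $s\in[0,\infty)^n$, $$\inf_{P:\ f_P|_D=f}\mathrm{wsize}_s(P,D)=\mathrm{ADV}^{\pm}_s(f),$$ where the infimum is over all span programs $P$ on $n$ bits with $f_P|_D=f$, and the infimum is attained. Moreover, it is attained by real canonical span programs obtained from Cholesky factorizations: the semi-definite program above has an optimal solution that has a Cholesky factorization, and for every optimal solution $X$ and every Cholesky factorization $(c_{x,j})$ of $X$ in $\mathbb R^m$ there is a real canonical span program $P$ with $f_P|_D=f$, $\mathrm{wsize}_s(P,D)=\mathrm{ADV}^{\pm}_s(f)$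 and $I_{j,b}=\{(j,b)\}\times[m]$ for all $j,b$, such that for all $x\in D$ with $f(x)=0$ and all $j,b,k$ the $x$-coordinate of the input vector with index $(j,b,k)$ is the $k$-th coordinate of $c_{x,j}$ if $x_j\ne b$, and $0$ if $x_j=b$. (For $D=\{0,1\}^n$ these conditions determine $P$.) -/

import Mathlib

universe u v

/-- A span program on `n` input bits: a target vector and finitely many input vectors in a
finite-dimensional complex inner product space.  The index set `I` of the input vectors is split
by `label`: the part `I_free` is the preimage of `none`, and the part `I_{j,b}` is the preimage of
`some (j, b)`. -/
structure SpanProgram (n : ℕ) where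
  V : Type u
  [instNormed : NormedAddCommGroup V]
  [instInner : InnerProductSpace ℂ V]
  [instFinDim : FiniteDimensional ℂ V]
  target : V
  I : Type v
  [instFintype : Fintype I]
  vec : I → V
  label : I → Option (Fin n × Bool)

attribute [instance] SpanProgram.instNormed SpanProgram.instInner SpanProgram.instFinDim
  SpanProgram.instFintype

namespace SpanProgram

variable {n : ℕ}

/-- The available indices `I(x) = I_free ∪ ⋃ j, I_{j, x_j}`. -/
def available (P : SpanProgram.{u, v} n) (x : Fin n → Bool) : Set P.I :=
  {i | P.label i = none ∨ ∃ j, P.label i = some (j, x j)}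

open Classical in
/-- The boolean function `f_P` computed by the span program `P`. -/
noncomputable def fn (P : SpanProgram.{u, v} n) (x : Fin n → Bool) : Bool :=
  decide (P.target ∈ Submodule.span ℂ (P.vec '' P.available x))

/-- The diagonal entry of `S²` at `i`: the cost `s_j` for `i ∈ I_{j,b}`, and `0` for free `i`. -/
def cost (P : SpanProgram.{u, v} n) (s : Fin n → ℝ) (i : P.I) : ℝ :=
  match P.label i with
  | none => 0
  | some (j, _) => s j

open Classical in
/-- `w` is a witness for `f_P(x) = 1`, that is, `A Π(x) w = t`, where `A w = ∑ i, w_i v_i`. -/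
def IsPosWitness (P : SpanProgram.{u, v} n) (x : Fin n → Bool) (w : P.I → ℂ) : Prop :=
  ∑ i, (if i ∈ P.available x then w i else 0) • P.vec i = P.target

/-- `w'` is a witness for `f_P(x) = 0`, that is, `⟨t, w'⟩ = 1` and `Π(x) A† w' = 0`,
where `(A† w')_i = ⟨v_i, w'⟩`. -/
def IsNegWitness (P : SpanProgram.{u, v} n) (x : Fin n → Bool) (w' : P.V) : Prop :=
  inner ℂ P.target w' = 1 ∧ ∀ i ∈ P.available x, inner ℂ (P.vec i) w' = 0

/-- The witness size of `P` on the input `x` with costs `s`: the minimum of `‖S w‖²` over the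
witnesses `w` if `f_P(x) = 1`, and the minimum of `‖S A† w'‖²` over the witnesses `w'` if
`f_P(x) = 0`. -/
noncomputable def wsizeAt (P : SpanProgram.{u, v} n) (s : Fin n → ℝ) (x : Fin n → Bool) : ℝ :=
  if P.fn x = true then
    sInf {r | ∃ w : P.I → ℂ, P.IsPosWitness x w ∧ r = ∑ i, P.cost s i * ‖w i‖ ^ 2}
  else
    sInf {r | ∃ w' : P.V, P.IsNegWitness x w' ∧
      r = ∑ i, P.cost s i * ‖(inner ℂ (P.vec i) w' : ℂ)‖ ^ 2}

/-- The witness size of `P` with costs `s`, restricted to the domain `D`: the maximum over `x ∈ D`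
(`0` if `D` is empty). -/
noncomputable def wsize (P : SpanProgram.{u, v} n) (s : Fin n → ℝ)
    (D : Finset (Fin n → Bool)) : ℝ :=
  ⨆ x : D, P.wsizeAt s x.1

/-- `f_P` agrees with the partial boolean function `f` on its domain. -/
def Computes (P : SpanProgram.{u, v} n) {D : Finset (Fin n → Bool)} (f : D → Bool) : Prop :=
  ∀ x : D, P.fn x.1 = f x

/-- `P` is real with respect to the basis `b`: the target and the input vectors have real
coordinates. -/
def IsRealIn (P : SpanProgram.{u, v} n) {ι : Type*} (b : Module.Basis ι ℂ P.V) : Prop :=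
  (∀ k, (b.repr P.target k).im = 0) ∧ ∀ i k, (b.repr (P.vec i) k).im = 0

/-- `P` is canonical, where the orthonormal basis `b`, indexed by `F₀ = {x | f_P(x) = 0}`,
identifies the inner product space of `P` with `ℂ^{F₀}`. -/
structure IsCanonicalIn (P : SpanProgram.{u, v} n)
    (b : OrthonormalBasis {x : Fin n → Bool // P.fn x = false} ℂ P.V) : Prop where
  strict : ∀ i, P.label i ≠ none
  target_eq : P.target = ∑ x, b x
  inner_eq_zero : ∀ (x : {x : Fin n → Bool // P.fn x = false}) (j : Fin n) (i : P.I),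
    P.label i = some (j, x.1 j) → inner ℂ (b x) (P.vec i) = 0

end SpanProgram

section Adversary

variable {n : ℕ} {D : Finset (Fin n → Bool)}

/-- The operator norm of a real square matrix with respect to the Euclidean norm. -/
noncomputable def matOpNorm {ι : Type*} [Fintype ι] [DecidableEq ι] (M : Matrix ι ι ℝ) : ℝ :=
  ‖Matrix.toEuclideanCLM (n := ι) (𝕜 := ℝ) M‖

/-- The `0`-`1` matrix `Δ_j` of the pairs of inputs that differ in the `j`-th bit. -/
def diffMatrix (D : Finset (Fin n → Bool)) (j : Fin n) : Matrix D D ℝ :=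
  Matrix.of fun x y => if x.1 j ≠ y.1 j then 1 else 0

/-- Adversary matrices for `f`. -/
structure IsAdversaryMatrix (f : D → Bool) (Γ : Matrix D D ℝ) : Prop where
  ne_zero : Γ ≠ 0
  symm : Γ.IsSymm
  eq_zero : ∀ x y, f x = f y → Γ x y = 0

/-- The general adversary bound of `f` with costs `s`: the maximum of `‖Γ‖` over the adversary
matrices `Γ` with `‖Γ ∘ Δ_j‖ ≤ s_j` for all `j` (`0` if there are none). -/
noncomputable def advPM (s : Fin n → ℝ) (f : D → Bool) : ℝ :=
  sSup {r | ∃ Γ : Matrix D D ℝ, IsAdversaryMatrix f Γ ∧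
    (∀ j, matOpNorm (Matrix.hadamard Γ (diffMatrix D j)) ≤ s j) ∧ r = matOpNorm Γ}

/-- Feasible solutions of the semi-definite program for `f`. -/
structure IsSDPFeasible (f : D → Bool) (X : Matrix (D × Fin n) (D × Fin n) ℝ) : Prop where
  posSemidef : X.PosSemidef
  sum_eq_one : ∀ x y : D, f x ≠ f y →
    ∑ j with x.1 j ≠ y.1 j, X (x, j) (y, j) = 1

/-- The objective function of the semi-definite program, with costs `s`
(a maximum over `D`, and `0` if `D` is empty). -/
noncomputable def sdpObjective (s : Fin n → ℝ) (X : Matrix (D × Fin n) (D × Fin n) ℝ) : ℝ :=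
  ⨆ x : D, ∑ j, s j * X (x, j) (x, j)

/-- Optimal solutions of the semi-definite program for `f` with costs `s`. -/
def IsSDPOptimal (s : Fin n → ℝ) (f : D → Bool) (X : Matrix (D × Fin n) (D × Fin n) ℝ) : Prop :=
  IsSDPFeasible f X ∧ ∀ Y, IsSDPFeasible f Y → sdpObjective s X ≤ sdpObjective s Y

/-- The vectors `c x j` in `ℝ^m` form a Cholesky factorization of `X`. -/
def IsCholesky (X : Matrix (D × Fin n) (D × Fin n) ℝ) {m : ℕ}
    (c : D → Fin n → EuclideanSpace ℝ (Fin m)) : Prop :=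
  ∀ x j y k, X (x, j) (y, k) = inner ℝ (c x j) (c y k)

/-- `P` is the span program built from the vectors `c x j`, in the coordinates given by the
orthonormal basis `b`: `I_{j,b} = [m]` for all `(j, b)`, and for each `x ∈ D` with `f(x) = 0` the
`x`-coordinate of the `k`-th vector in `I_{j,b}` is the `k`-th coordinate of `c x j` if `x_j ≠ b`,
and `0` otherwise. -/
def IsBuiltFrom (f : D → Bool) {m : ℕ} (c : D → Fin n → EuclideanSpace ℝ (Fin m))
    (P : SpanProgram.{u, v} n)
    (b : OrthonormalBasis {x : Fin n → Bool // P.fn x = false} ℂ P.V) : Prop :=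
  ∃ e : Fin n × Bool × Fin m ≃ P.I,
    (∀ j β k, P.label (e (j, β, k)) = some (j, β)) ∧
    ∀ (x : D) (hx : P.fn x.1 = false), f x = false → ∀ j β k,
      b.repr (P.vec (e (j, β, k))) ⟨x.1, hx⟩ = if x.1 j ≠ β then ((c x j k : ℝ) : ℂ) else 0

end Adversary

/-! ### Gram vectors and operator norms of real matrices. -/

section RealMatrices

variable {ι κ : Type*} [Fintype ι] [Fintype κ]

/-! Both sides equal the optimal value of the semi-definite program, whose solutions are read as
Gram matrices of vectors `c x j`.

The adversary bound is the dual program. Weak duality (`matOpNorm_le_of_vectors`) holds because the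
constraint writes Γ as a sum over j, k of the matrices Γ ∘ Δ_j, scaled on both sides by the diagonal
matrices with entries `c x j k`. For strong duality, a functional separating the desired value from
`sdpCone` would yield, after symmetrizing and rescaling, an adversary matrix that is too good
(`sum_le_mul_advPM`). So the value lies in the closure of the cone, and compactness gives attainment
(`exists_isSDPFeasible_of_mem_closure`).

A span program for f yields feasible vectors (`Computes.advPM_le_wsize`): if w is a witness for a
positive x and w' one for a negative y, then ⟨Π(x)w, A†w'⟩ = ⟨t, w'⟩ = 1, and only indices labelled
(j, x_j) with x_j ≠ y_j contribute.

Conversely, feasible vectors give a program in which the vectors `c y j` form a witness for a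
positive y in D and the basis vector at x is a witness for a negative x in D. A canonical program
also needs a coordinate for each rejected input outside D. That coordinate is taken to be an affine
combination of those at the negative inputs in D, which leaves the computed function unchanged
(`canonicalProgram_fn_eq_false_iff`). -/

theorem posSemidef_real_iff (M : Matrix ι ι ℝ) :
    M.PosSemidef ↔ (∀ i j, M i j = M j i) ∧ ∀ z : ι → ℝ, 0 ≤ ∑ i, ∑ j, z i * M i j * z j := by
  rw [Matrix.posSemidef_iff_dotProduct_mulVec]
  refine and_congr ⟨fun h i j => ?_, fun h => ?_⟩ (forall_congr' fun z => ?_)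
  · simpa using (h.apply i j).symm
  · ext i j
    simpa using h j i
  · simp [dotProduct, Matrix.mulVec, Finset.mul_sum, mul_assoc]

/-- A Gram matrix of real vectors is positive semi-definite. -/
theorem posSemidef_gram (c : ι → κ → ℝ) :
    (Matrix.of fun i j => ∑ k, c i k * c j k : Matrix ι ι ℝ).PosSemidef := by
  have h := Matrix.posSemidef_self_mul_conjTranspose (Matrix.of c)
  convert h using 1
  ext i j
  simp [Matrix.mul_apply]

open scoped MatrixOrder in
theorem exists_gram_of_posSemidef {M : Matrix ι ι ℝ} (hM : M.PosSemidef) :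
    ∃ c : ι → ι → ℝ, ∀ i j, M i j = ∑ k, c i k * c j k := by
  classical
  obtain ⟨B, rfl⟩ := CStarAlgebra.nonneg_iff_eq_star_mul_self.mp hM.nonneg
  exact ⟨fun i k => B k i, fun i j => by simp [Matrix.mul_apply, Matrix.star_apply]⟩

/-- AM-GM for Gram vectors. It turns bounds on the diagonal into the entrywise bounds needed for
compactness. -/
theorem abs_apply_le_of_posSemidef {M : Matrix ι ι ℝ} (hM : M.PosSemidef) (i j : ι) :
    |M i j| ≤ (M i i + M j j) / 2 := by
  obtain ⟨c, hc⟩ := exists_gram_of_posSemidef hM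
  rw [hc, hc, hc, ← Finset.sum_add_distrib, Finset.sum_div]
  refine (Finset.abs_sum_le_sum_abs _ _).trans (Finset.sum_le_sum fun k _ => ?_)
  rw [abs_le]
  constructor <;> nlinarith [sq_nonneg (c i k + c j k), sq_nonneg (c i k - c j k)]

variable [DecidableEq ι]

theorem inner_toEuclideanCLM_eq_sum (M : Matrix ι ι ℝ) (u w : EuclideanSpace ℝ ι) :
    inner ℝ u (Matrix.toEuclideanCLM (n := ι) (𝕜 := ℝ) M w) = ∑ x, ∑ y, u x * M x y * w y := by
  rw [Matrix.inner_toEuclideanCLM]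
  simp [dotProduct, Matrix.mulVec, Finset.mul_sum, mul_assoc]

/-- The arithmetic mean of the squared norms, in place of the product of the norms, makes the bound
additive over families of vectors. -/
theorem sum_le_matOpNorm (M : Matrix ι ι ℝ) (u w : ι → ℝ) :
    ∑ x, ∑ y, u x * M x y * w y ≤ matOpNorm M * ((∑ x, u x ^ 2 + ∑ x, w x ^ 2) / 2) := by
  set U : EuclideanSpace ℝ ι := WithLp.toLp 2 u
  set W : EuclideanSpace ℝ ι := WithLp.toLp 2 w
  have hU : ‖U‖ ^ 2 = ∑ x, u x ^ 2 := by simp [EuclideanSpace.norm_sq_eq, U]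
  have hW : ‖W‖ ^ 2 = ∑ x, w x ^ 2 := by simp [EuclideanSpace.norm_sq_eq, W]
  have h := inner_toEuclideanCLM_eq_sum M U W
  change _ = ∑ x, ∑ y, u x * M x y * w y at h
  rw [← h, ← hU, ← hW]
  have h0 : 0 ≤ matOpNorm M := norm_nonneg _
  calc _ ≤ ‖U‖ * ‖Matrix.toEuclideanCLM (n := ι) (𝕜 := ℝ) M W‖ := real_inner_le_norm _ _
    _ ≤ ‖U‖ * (matOpNorm M * ‖W‖) := by
        gcongr
        exact ContinuousLinearMap.le_opNorm _ _
    _ ≤ _ := by nlinarith [mul_nonneg h0 (sq_nonneg (‖U‖ - ‖W‖))]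

theorem matOpNorm_le {M : Matrix ι ι ℝ} {r : ℝ} (hr : 0 ≤ r)
    (h : ∀ u w : ι → ℝ, ∑ x, ∑ y, u x * M x y * w y ≤ r * ((∑ x, u x ^ 2 + ∑ x, w x ^ 2) / 2)) :
    matOpNorm M ≤ r := by
  refine ContinuousLinearMap.opNorm_le_bound _ hr fun w => ?_
  set T := Matrix.toEuclideanCLM (n := ι) (𝕜 := ℝ) M
  rcases eq_or_ne (T w) 0 with h0 | h0
  · rw [h0, norm_zero]
    positivity
  have hw : w ≠ 0 := by
    rintro rfl
    simp at h0
  have ha : 0 < ‖w‖ := norm_pos_iff.mpr hw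
  have hb : 0 < ‖T w‖ := norm_pos_iff.mpr h0
  -- Rescaled to the norm of `w`, so that the arithmetic mean in `h` loses nothing.
  set U : EuclideanSpace ℝ ι := (‖w‖ / ‖T w‖) • T w
  have hU : ‖U‖ = ‖w‖ := by
    rw [norm_smul, norm_div, norm_norm, norm_norm]
    field_simp
  have h1 := h U w
  rw [← inner_toEuclideanCLM_eq_sum] at h1
  have e : inner ℝ U (T w) = ‖w‖ * ‖T w‖ := by
    rw [real_inner_smul_left, real_inner_self_eq_norm_sq]
    field_simp
  have hU2 : ∑ x, U x ^ 2 = ‖w‖ ^ 2 := by rw [← hU]; simp [EuclideanSpace.norm_sq_eq]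
  have hW2 : ∑ x, w x ^ 2 = ‖w‖ ^ 2 := by simp [EuclideanSpace.norm_sq_eq]
  rw [hU2, hW2, e] at h1
  have h2 : ‖w‖ * ‖T w‖ ≤ ‖w‖ * (r * ‖w‖) := by linarith [h1]
  exact le_of_mul_le_mul_left h2 ha

/-- The quadratic form of a symmetric matrix controls its operator norm. -/
theorem matOpNorm_le_of_quadratic {M : Matrix ι ι ℝ} (hM : ∀ x y, M x y = M y x) {r : ℝ}
    (hr : 0 ≤ r) (h : ∀ z : ι → ℝ, |∑ x, ∑ y, z x * M x y * z y| ≤ r * ∑ x, z x ^ 2) :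
    matOpNorm M ≤ r := by
  refine matOpNorm_le hr fun u w => ?_
  -- Polarization: the forms at `u + w` and `u - w` differ by four times the bilinear form.
  have h1 := (abs_le.mp (h (u + w))).2
  have h2 := (abs_le.mp (h (u - w))).1
  have hs : ∑ x, ∑ y, w x * M x y * u y = ∑ x, ∑ y, u x * M x y * w y := by
    rw [Finset.sum_comm]
    refine Finset.sum_congr rfl fun x _ => Finset.sum_congr rfl fun y _ => ?_
    rw [hM]
    ring
  simp only [Pi.add_apply, Pi.sub_apply, add_mul, mul_add, sub_mul, mul_sub,
    Finset.sum_add_distrib, Finset.sum_sub_distrib, add_sq, sub_sq] at h1 h2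
  rw [hs] at h1 h2
  linarith

end RealMatrices

/-! ### Weak duality. -/

section WeakDuality

variable {n : ℕ} {D : Finset (Fin n → Bool)}

/-- Weak duality between the adversary bound and the semi-definite program, the latter in terms of
Gram vectors. -/
theorem matOpNorm_le_of_vectors {κ : Type*} [Fintype κ] {s : Fin n → ℝ} {f : D → Bool}
    (c : D → Fin n → κ → ℝ)
    (hc : ∀ x y : D, f x ≠ f y → ∑ j with x.1 j ≠ y.1 j, ∑ k, c x j k * c y j k = 1)
    {r : ℝ} (hr : 0 ≤ r) (hcr : ∀ x, ∑ j, s j * ∑ k, c x j k ^ 2 ≤ r)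
    {Γ : Matrix D D ℝ} (hΓ : IsAdversaryMatrix f Γ)
    (hΓs : ∀ j, matOpNorm (Matrix.hadamard Γ (diffMatrix D j)) ≤ s j) :
    matOpNorm Γ ≤ r := by
  refine matOpNorm_le hr fun u w => ?_
  have key : ∀ x y, Γ x y =
      ∑ j, ∑ k, c x j k * Matrix.hadamard Γ (diffMatrix D j) x y * c y j k := by
    intro x y
    by_cases hf : f x = f y
    · simp [hΓ.eq_zero x y hf]
    · have h := hc x y hf
      rw [Finset.sum_filter] at h
      calc Γ x y = Γ x y * ∑ j, (if x.1 j ≠ y.1 j then ∑ k, c x j k * c y j k else 0) := by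
            rw [h, mul_one]
        _ = _ := by
            rw [Finset.mul_sum]
            refine Finset.sum_congr rfl fun j _ => ?_
            simp only [Matrix.hadamard_apply, diffMatrix, Matrix.of_apply]
            split_ifs
            · rw [Finset.mul_sum]
              exact Finset.sum_congr rfl fun k _ => by ring
            · simp
  have swap : ∑ x, ∑ y, u x * Γ x y * w y = ∑ j, ∑ k, ∑ x, ∑ y,
      (u x * c x j k) * Matrix.hadamard Γ (diffMatrix D j) x y * (w y * c y j k) := by
    calc _ = ∑ x, ∑ y, ∑ j, ∑ k,
        (u x * c x j k) * Matrix.hadamard Γ (diffMatrix D j) x y * (w y * c y j k) := by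
          refine Finset.sum_congr rfl fun x _ => Finset.sum_congr rfl fun y _ => ?_
          rw [key x y, Finset.mul_sum, Finset.sum_mul]
          refine Finset.sum_congr rfl fun j _ => ?_
          rw [Finset.mul_sum, Finset.sum_mul]
          exact Finset.sum_congr rfl fun k _ => by ring
      _ = _ := by
          simp_rw [Finset.sum_comm (s := (Finset.univ : Finset D))
              (t := (Finset.univ : Finset (Fin n))),
            Finset.sum_comm (s := (Finset.univ : Finset D)) (t := (Finset.univ : Finset κ))]
  -- Summed over x first, the weight of `v x ^ 2` is the objective at x, hence at most `r`.
  have bound : ∀ v : D → ℝ, ∑ j, ∑ k, s j * ∑ x, (v x * c x j k) ^ 2 ≤ r * ∑ x, v x ^ 2 := by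
    intro v
    calc _ = ∑ x, v x ^ 2 * ∑ j, s j * ∑ k, c x j k ^ 2 := by
          simp_rw [Finset.mul_sum]
          simp_rw [Finset.sum_comm (s := (Finset.univ : Finset D))
              (t := (Finset.univ : Finset (Fin n))),
            Finset.sum_comm (s := (Finset.univ : Finset D)) (t := (Finset.univ : Finset κ))]
          refine Finset.sum_congr rfl fun j _ => Finset.sum_congr rfl fun k _ =>
            Finset.sum_congr rfl fun x _ => by ring
      _ ≤ _ := by
          rw [Finset.mul_sum]
          refine Finset.sum_le_sum fun x _ => ?_
          rw [mul_comm r]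
          exact mul_le_mul_of_nonneg_left (hcr x) (sq_nonneg _)
  rw [swap]
  calc _ ≤ ∑ j, ∑ k, s j * ((∑ x, (u x * c x j k) ^ 2 + ∑ x, (w x * c x j k) ^ 2) / 2) := by
        refine Finset.sum_le_sum fun j _ => Finset.sum_le_sum fun k _ => ?_
        refine (sum_le_matOpNorm _ (fun x => u x * c x j k) (fun x => w x * c x j k)).trans ?_
        exact mul_le_mul_of_nonneg_right (hΓs j) (by positivity)
    _ = (∑ j, ∑ k, s j * ∑ x, (u x * c x j k) ^ 2 +
          ∑ j, ∑ k, s j * ∑ x, (w x * c x j k) ^ 2) / 2 := by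
        rw [← Finset.sum_add_distrib, Finset.sum_div]
        refine Finset.sum_congr rfl fun j _ => ?_
        rw [← Finset.sum_add_distrib, Finset.sum_div]
        exact Finset.sum_congr rfl fun k _ => by rw [← mul_add, mul_div_assoc]
    _ ≤ _ := by linarith [bound u, bound w]

theorem advPM_nonneg (s : Fin n → ℝ) (f : D → Bool) : 0 ≤ advPM s f :=
  Real.sSup_nonneg fun _ ⟨_, _, _, h⟩ => h ▸ norm_nonneg _

theorem advPM_le_of_vectors {κ : Type*} [Fintype κ] {s : Fin n → ℝ} {f : D → Bool}
    (c : D → Fin n → κ → ℝ)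
    (hc : ∀ x y : D, f x ≠ f y → ∑ j with x.1 j ≠ y.1 j, ∑ k, c x j k * c y j k = 1)
    {r : ℝ} (hr : 0 ≤ r) (hcr : ∀ x, ∑ j, s j * ∑ k, c x j k ^ 2 ≤ r) :
    advPM s f ≤ r :=
  Real.sSup_le (fun _ ⟨_, hΓ, hs, h⟩ => h ▸ matOpNorm_le_of_vectors c hc hr hcr hΓ hs) hr

theorem le_sdpObjective (s : Fin n → ℝ) (X : Matrix (D × Fin n) (D × Fin n) ℝ) (x : D) :
    ∑ j, s j * X (x, j) (x, j) ≤ sdpObjective s X :=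
  le_ciSup (f := fun x : D => ∑ j, s j * X (x, j) (x, j)) (Set.finite_range _).bddAbove x

theorem sdpObjective_nonneg {s : Fin n → ℝ} (hs : ∀ j, 0 ≤ s j)
    {X : Matrix (D × Fin n) (D × Fin n) ℝ} (hX : X.PosSemidef) : 0 ≤ sdpObjective s X :=
  Real.iSup_nonneg fun _ => Finset.sum_nonneg fun j _ => mul_nonneg (hs j) hX.diag_nonneg

theorem matOpNorm_le_sdpObjective {s : Fin n → ℝ} (hs : ∀ j, 0 ≤ s j) {f : D → Bool}
    {X : Matrix (D × Fin n) (D × Fin n) ℝ} (hX : IsSDPFeasible f X)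
    {Γ : Matrix D D ℝ} (hΓ : IsAdversaryMatrix f Γ)
    (hΓs : ∀ j, matOpNorm (Matrix.hadamard Γ (diffMatrix D j)) ≤ s j) :
    matOpNorm Γ ≤ sdpObjective s X := by
  obtain ⟨c, hc⟩ := exists_gram_of_posSemidef hX.posSemidef
  refine matOpNorm_le_of_vectors (fun x j => c (x, j)) (fun x y h => ?_)
    (sdpObjective_nonneg hs hX.posSemidef) (fun x => ?_) hΓ hΓs
  · simpa only [hc] using hX.sum_eq_one x y h
  · refine le_trans (le_of_eq ?_) (le_sdpObjective s X x)
    simp only [hc, sq]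

theorem advPM_le_sdpObjective {s : Fin n → ℝ} (hs : ∀ j, 0 ≤ s j) {f : D → Bool}
    {X : Matrix (D × Fin n) (D × Fin n) ℝ} (hX : IsSDPFeasible f X) :
    advPM s f ≤ sdpObjective s X :=
  Real.sSup_le (fun _ ⟨_, hΓ, h, e⟩ => e ▸ matOpNorm_le_sdpObjective hs hX hΓ h)
    (sdpObjective_nonneg hs hX.posSemidef)

end WeakDuality

/-! ### Strong duality and attainment. -/

section StrongDuality

open Filter Topology

variable {n : ℕ} {D : Finset (Fin n → Bool)}

/-- On the coordinates in `J`, the entries of a positive semi-definite matrix between the two fibres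
of `f` can be prescribed, without changing the diagonal at the other coordinates. -/
theorem exists_posSemidef_prescribed (f : D → Bool) (J : Finset (Fin n)) (A : D → D → ℝ)
    (hA : ∀ x y, A x y = A y x) :
    ∃ X : Matrix (D × Fin n) (D × Fin n) ℝ, X.PosSemidef ∧
      (∀ x, ∀ j ∉ J, X (x, j) (x, j) = 0) ∧
      ∀ x y, f x ≠ f y → ∑ j with x.1 j ≠ y.1 j, X (x, j) (y, j) =
        if ∃ j ∈ J, x.1 j ≠ y.1 j then A x y else 0 := by
  classical
  let N : D → D → Finset (Fin n) := fun x y => {j ∈ J | x.1 j ≠ y.1 j}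
  have hN : ∀ x y, N x y = N y x := fun x y => by simp only [N, ne_comm]
  -- The prescribed value is shared equally among the coordinates of `J` where x and y differ.
  let B : D → D → ℝ := fun x y => A x y / (N x y).card
  have hB : ∀ x y, B x y = B y x := fun x y => by simp only [B, hA x y, hN x y]
  -- At each j in `J`, a negative input gets its own unit vector and a positive one lists its values
  -- `B` against all negative inputs, so the inner products across the fibres are exactly `B`.
  let c : D × Fin n → D × Fin n → ℝ := fun p q =>
    if p.2 = q.2 ∧ p.2 ∈ J then
      (if f p.1 = false then (if p.1 = q.1 then 1 else 0)
        else (if f q.1 = false then B p.1 q.1 else 0))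
    else 0
  let X : Matrix (D × Fin n) (D × Fin n) ℝ := Matrix.of fun p q => ∑ k, c p k * c q k
  have hX : X.PosSemidef := posSemidef_gram c
  have hXs : ∀ p q, X p q = X q p := ((posSemidef_real_iff X).mp hX).1
  have hX0 : ∀ x y j, j ∉ J → X (x, j) (y, j) = 0 := fun x y j hj => by simp [X, c, hj]
  have hX1 : ∀ x y j, j ∈ J → f x = false → f y = true → X (x, j) (y, j) = B x y := by
    intro x y j hj hx hy
    simp only [X, c, Matrix.of_apply, Fintype.sum_prod_type]
    rw [Finset.sum_eq_single x, Finset.sum_eq_single j]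
    · simp [hj, hx, hy, hB x y]
    · intro k _ hk
      simp [hk.symm]
    · simp
    · intro z _ hz
      simp [hx, hz.symm]
    · simp
  have hX2 : ∀ x y j, j ∈ J → f x ≠ f y → X (x, j) (y, j) = B x y := by
    intro x y j hj hxy
    rcases hx : f x with _ | _
    · exact hX1 x y j hj hx (by rw [hx] at hxy; simpa using hxy.symm)
    · rw [hXs, hB]
      exact hX1 y x j hj (by rw [hx] at hxy; simpa using hxy.symm) hx
  refine ⟨X, hX, fun x j hj => hX0 x x j hj, fun x y hxy => ?_⟩
  have h1 : ∑ j with x.1 j ≠ y.1 j, X (x, j) (y, j) = ∑ j ∈ N x y, B x y := by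
    symm
    calc _ = ∑ j ∈ N x y, X (x, j) (y, j) := by
          refine Finset.sum_congr rfl fun j hj => ?_
          exact (hX2 x y j (Finset.mem_filter.mp hj).1 hxy).symm
      _ = _ := by
          refine Finset.sum_subset (Finset.filter_subset_filter _ (Finset.subset_univ _)) ?_
          intro j hj hj'
          refine hX0 x y j fun hJ => hj' ?_
          exact Finset.mem_filter.mpr ⟨hJ, (Finset.mem_filter.mp hj).2⟩
  rw [h1, Finset.sum_const, nsmul_eq_mul]
  split_ifs with h
  · have : ((N x y).card : ℝ) ≠ 0 := by
      obtain ⟨j, hj, hne⟩ := h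
      exact_mod_cast (Finset.card_pos.mpr ⟨j, Finset.mem_filter.mpr ⟨hj, hne⟩⟩).ne'
    simp only [B]
    field_simp
  · have : N x y = ∅ := Finset.filter_eq_empty_iff.mpr fun j hj hne => h ⟨j, hj, hne⟩
    simp [this]

theorem exists_isSDPFeasible (f : D → Bool) : ∃ X, IsSDPFeasible f X := by
  obtain ⟨X, hX, -, h⟩ := exists_posSemidef_prescribed f Finset.univ (fun _ _ => 1)
    fun _ _ => rfl
  refine ⟨X, hX, fun x y hxy => ?_⟩
  rw [h x y hxy, if_pos]
  by_contra! hc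
  refine hxy (congrArg f (Subtype.ext (funext fun j => hc j (Finset.mem_univ _))))

/-- Weak duality against one feasible point bounds the set in `advPM`, so its `sSup` is a true
supremum. -/
theorem matOpNorm_le_advPM {s : Fin n → ℝ} (hs : ∀ j, 0 ≤ s j) {f : D → Bool}
    {Γ : Matrix D D ℝ} (hΓ : IsAdversaryMatrix f Γ)
    (hΓs : ∀ j, matOpNorm (Matrix.hadamard Γ (diffMatrix D j)) ≤ s j) :
    matOpNorm Γ ≤ advPM s f := by
  obtain ⟨X, hX⟩ := exists_isSDPFeasible f
  refine le_csSup ⟨sdpObjective s X, ?_⟩ ⟨Γ, hΓ, hΓs, rfl⟩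
  rintro _ ⟨Γ', h, h', rfl⟩
  exact matOpNorm_le_sdpObjective hs hX h h'

/-- Dividing `G x y` by √(b x · b y) turns the weighted form bounds into norm bounds for an
adversary matrix Γ, and the sum of `G` is the form of Γ at the vector √b. -/
theorem sum_le_mul_advPM_of_pos {s : Fin n → ℝ} (hs : ∀ j, 0 ≤ s j) {f : D → Bool} (G : D → D → ℝ)
    (hG : ∀ x y, G x y = G y x) (hG0 : ∀ x y, f x = f y → G x y = 0) (b : D → ℝ)
    (hb : ∀ x, 0 < b x)
    (h : ∀ j (z : D → ℝ), ∑ x, ∑ y, z x * (G x y * diffMatrix D j x y) * z y ≤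
      s j * ∑ x, b x * z x ^ 2) :
    ∑ x, ∑ y, G x y ≤ advPM s f * ∑ x, b x := by
  have hsum : 0 ≤ ∑ x, b x := Finset.sum_nonneg fun x _ => (hb x).le
  let r : D → ℝ := fun x => √(b x)
  have hr : ∀ x, 0 < r x := fun x => Real.sqrt_pos.mpr (hb x)
  have hr2 : ∀ x, r x ^ 2 = b x := fun x => Real.sq_sqrt (hb x).le
  let Γ : Matrix D D ℝ := Matrix.of fun x y => G x y / (r x * r y)
  have hΓs : ∀ x y, Γ x y = Γ y x := fun x y => by
    simp only [Γ, Matrix.of_apply, hG x y, mul_comm (r x)]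
  have hval : ∑ x, ∑ y, r x * Γ x y * r y = ∑ x, ∑ y, G x y := by
    refine Finset.sum_congr rfl fun x _ => Finset.sum_congr rfl fun y _ => ?_
    have := (hr x).ne'
    have := (hr y).ne'
    simp only [Γ, Matrix.of_apply]
    field_simp
  have hle : ∑ x, ∑ y, G x y ≤ matOpNorm Γ * ∑ x, b x := by
    have := sum_le_matOpNorm Γ r r
    simp only [hr2] at this
    rw [hval] at this
    linarith
  by_cases hΓ0 : Γ = 0
  · have h0 : ∑ x, ∑ y, G x y = 0 := by rw [← hval]; simp [hΓ0]
    rw [h0]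
    exact mul_nonneg (advPM_nonneg s f) hsum
  have hΓ : IsAdversaryMatrix f Γ :=
    ⟨hΓ0, Matrix.IsSymm.ext fun x y => hΓs y x, fun x y hxy => by simp [Γ, hG0 x y hxy]⟩
  refine hle.trans (mul_le_mul_of_nonneg_right (matOpNorm_le_advPM hs hΓ fun j => ?_) hsum)
  refine matOpNorm_le_of_quadratic (fun x y => ?_) (hs j) fun z => ?_
  · simp only [Matrix.hadamard_apply, diffMatrix, Matrix.of_apply, hΓs x y, ne_comm]
  have hz2 : ∀ ε : D → ℝ, (∀ x, ε x ^ 2 = 1) →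
      ∑ x, b x * (ε x * (z x / r x)) ^ 2 = ∑ x, z x ^ 2 := by
    intro ε hε
    refine Finset.sum_congr rfl fun x _ => ?_
    have := (hr x).ne'
    rw [mul_pow, hε, ← hr2]
    field_simp
  have hq : ∑ x, ∑ y, z x * Matrix.hadamard Γ (diffMatrix D j) x y * z y =
      ∑ x, ∑ y, (1 * (z x / r x)) * (G x y * diffMatrix D j x y) * (1 * (z y / r y)) := by
    refine Finset.sum_congr rfl fun x _ => Finset.sum_congr rfl fun y _ => ?_
    have := (hr x).ne'
    have := (hr y).ne'
    simp only [Γ, Matrix.of_apply, Matrix.hadamard_apply]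
    field_simp
  -- `G` is supported on pairs from opposite fibres, so flipping signs on one fibre negates the
  -- form. The one-sided hypothesis thereby becomes two-sided.
  let ε : D → ℝ := fun x => if f x = true then 1 else -1
  have hε : ∀ x, ε x ^ 2 = 1 := fun x => by simp only [ε]; split_ifs <;> norm_num
  have hneg : ∑ x, ∑ y, (ε x * (z x / r x)) * (G x y * diffMatrix D j x y) * (ε y * (z y / r y)) =
      -∑ x, ∑ y, z x * Matrix.hadamard Γ (diffMatrix D j) x y * z y := by
    rw [hq]
    simp_rw [← Finset.sum_neg_distrib]
    refine Finset.sum_congr rfl fun x _ => Finset.sum_congr rfl fun y _ => ?_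
    by_cases hxy : f x = f y
    · simp [hG0 x y hxy]
    · have : ε x * ε y = -1 := by
        simp only [ε]
        rcases hx : f x <;> rcases hy : f y <;> simp_all
      linear_combination (z x / r x) * (G x y * diffMatrix D j x y) * (z y / r y) * this
  have h1 := h j fun x => 1 * (z x / r x)
  have h2 := h j fun x => ε x * (z x / r x)
  rw [← hq, hz2 (fun _ => 1) (by simp)] at h1
  rw [hneg, hz2 ε hε] at h2
  exact abs_le.mpr ⟨by linarith, h1⟩

/-- Vanishing weights are reached by adding δ > 0 to all weights and letting δ tend to 0. -/
theorem sum_le_mul_advPM {s : Fin n → ℝ} (hs : ∀ j, 0 ≤ s j) {f : D → Bool} (G : D → D → ℝ)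
    (hG : ∀ x y, G x y = G y x) (hG0 : ∀ x y, f x = f y → G x y = 0) (b : D → ℝ)
    (hb : ∀ x, 0 ≤ b x)
    (h : ∀ j (z : D → ℝ), ∑ x, ∑ y, z x * (G x y * diffMatrix D j x y) * z y ≤
      s j * ∑ x, b x * z x ^ 2) :
    ∑ x, ∑ y, G x y ≤ advPM s f * ∑ x, b x := by
  have hlim : Tendsto (fun δ : ℝ => advPM s f * ∑ x, (b x + δ)) (𝓝[>] 0)
      (𝓝 (advPM s f * ∑ x, b x)) := by
    have : Continuous fun δ : ℝ => advPM s f * ∑ x, (b x + δ) := by fun_prop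
    simpa using (this.tendsto 0).mono_left nhdsWithin_le_nhds
  refine ge_of_tendsto hlim (eventually_mem_nhdsWithin.mono fun δ (hδ : 0 < δ) => ?_)
  refine sum_le_mul_advPM_of_pos hs G hG hG0 _ (fun x => add_pos_of_nonneg_of_pos (hb x) hδ)
    fun j z => (h j z).trans (mul_le_mul_of_nonneg_left ?_ (hs j))
  exact Finset.sum_le_sum fun x _ => by nlinarith [sq_nonneg (z x)]

theorem continuousLinearMap_prod_pi_apply {ι κ : Type*} [Fintype ι] [Fintype κ] [DecidableEq ι]
    [DecidableEq κ] (φ : ((ι → ℝ) × (κ → ℝ)) →L[ℝ] ℝ) (p : (ι → ℝ) × (κ → ℝ)) :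
    φ p = ∑ i, p.1 i * φ (Pi.single i 1, 0) + ∑ k, p.2 k * φ (0, Pi.single k 1) := by
  have hp : p = ∑ i, p.1 i • ((Pi.single i 1, 0) : (ι → ℝ) × (κ → ℝ)) +
      ∑ k, p.2 k • ((0, Pi.single k 1) : (ι → ℝ) × (κ → ℝ)) := by
    ext l
    · simp [Prod.fst_sum, Finset.sum_apply, Pi.single_apply]
    · simp [Prod.snd_sum, Finset.sum_apply, Pi.single_apply]
  conv_lhs => rw [hp]
  simp only [map_add, map_sum, map_smul, smul_eq_mul]

/-- The cone of the constraint values and the upper bounds for the objective that positive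
semi-definite matrices attain. -/
def sdpCone (s : Fin n → ℝ) (f : D → Bool) : Set ((D × D → ℝ) × (D → ℝ)) :=
  {p | ∃ X : Matrix (D × Fin n) (D × Fin n) ℝ, X.PosSemidef ∧
    (∀ x y, f x ≠ f y → ∑ j with x.1 j ≠ y.1 j, X (x, j) (y, j) = p.1 (x, y)) ∧
    ∀ x, ∑ j, s j * X (x, j) (x, j) ≤ p.2 x}

theorem smul_mem_sdpCone {s : Fin n → ℝ} {f : D → Bool} {p : (D × D → ℝ) × (D → ℝ)}
    (hp : p ∈ sdpCone s f) {t : ℝ} (ht : 0 ≤ t) : t • p ∈ sdpCone s f := by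
  obtain ⟨X, hX, h1, h2⟩ := hp
  refine ⟨t • X, hX.smul ht, fun x y hxy => ?_, fun x => ?_⟩
  · simp [← Finset.mul_sum, h1 x y hxy]
  · refine le_trans (le_of_eq ?_) (mul_le_mul_of_nonneg_left (h2 x) ht)
    rw [Finset.mul_sum]
    exact Finset.sum_congr rfl fun j _ => by simp; ring

theorem add_mem_sdpCone {s : Fin n → ℝ} {f : D → Bool} {p q : (D × D → ℝ) × (D → ℝ)}
    (hp : p ∈ sdpCone s f) (hq : q ∈ sdpCone s f) : p + q ∈ sdpCone s f := by
  obtain ⟨X, hX, h1, h2⟩ := hp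
  obtain ⟨Y, hY, h3, h4⟩ := hq
  refine ⟨X + Y, hX.add hY, fun x y hxy => ?_, fun x => ?_⟩
  · simp [Finset.sum_add_distrib, h1 x y hxy, h3 x y hxy]
  · simpa [mul_add, Finset.sum_add_distrib] using add_le_add (h2 x) (h4 x)

theorem convex_sdpCone (s : Fin n → ℝ) (f : D → Bool) : Convex ℝ (sdpCone s f) :=
  fun _ hp _ hq _ _ ha hb _ => add_mem_sdpCone (smul_mem_sdpCone hp ha) (smul_mem_sdpCone hq hb)

theorem advPM_mem_closure_sdpCone {s : Fin n → ℝ} (hs : ∀ j, 0 ≤ s j) (f : D → Bool) :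
    ((fun _ => 1, fun _ => advPM s f) : (D × D → ℝ) × (D → ℝ)) ∈ closure (sdpCone s f) := by
  classical
  by_contra hp
  obtain ⟨φ, u, hu, hφ⟩ :=
    geometric_hahn_banach_point_closed (convex_sdpCone s f).closure isClosed_closure hp
  have hφ' : ∀ p ∈ sdpCone s f, u < φ p := fun p h => hφ p (subset_closure h)
  have h0 : (0 : (D × D → ℝ) × (D → ℝ)) ∈ sdpCone s f :=
    ⟨0, Matrix.PosSemidef.zero, by simp, by simp⟩
  have hu0 : u < 0 := by simpa using hφ' _ h0
  have hnn : ∀ p ∈ sdpCone s f, 0 ≤ φ p := by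
    intro p hp
    by_contra! hlt
    -- This multiple of `p` stays in the cone and has `φ`-value exactly `u`.
    have h := hφ' _ (smul_mem_sdpCone hp (t := u / φ p) (div_nonneg_of_nonpos hu0.le hlt.le))
    rw [map_smul, smul_eq_mul, div_mul_cancel₀ _ hlt.ne] at h
    exact lt_irrefl _ h
  let a : D → D → ℝ := fun x y => φ (Pi.single (x, y) 1, 0)
  let b : D → ℝ := fun x => φ (0, Pi.single x 1)
  have hrep : ∀ p : (D × D → ℝ) × (D → ℝ),
      φ p = ∑ x, ∑ y, p.1 (x, y) * a x y + ∑ x, p.2 x * b x := by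
    intro p
    rw [continuousLinearMap_prod_pi_apply φ p, Fintype.sum_prod_type]
  have hb : ∀ x, 0 ≤ b x := fun x =>
    hnn _ ⟨0, Matrix.PosSemidef.zero, by simp, fun y => by
      simp only [Matrix.zero_apply, mul_zero, Finset.sum_const_zero, Pi.single_apply]
      split_ifs
      exacts [zero_le_one, le_rfl]⟩
  -- The cone leaves these coordinates free, so it contains a full line in each such direction.
  have ha0 : ∀ x y, f x = f y → a x y = 0 := by
    intro x y hxy
    have hmem : ∀ t : ℝ, ((Pi.single (x, y) t, 0) : (D × D → ℝ) × (D → ℝ)) ∈ sdpCone s f := by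
      refine fun t => ⟨0, Matrix.PosSemidef.zero, fun x' y' h => ?_, by simp⟩
      have hne : (x', y') ≠ (x, y) := by
        rintro ⟨⟩
        exact h hxy
      simp [Pi.single_eq_of_ne hne]
    have h1 := hnn _ (hmem 1)
    have h2 := hnn _ (hmem (-1))
    have e : ((Pi.single (x, y) (-1), 0) : (D × D → ℝ) × (D → ℝ)) =
        -((Pi.single (x, y) 1, 0) : (D × D → ℝ) × (D → ℝ)) := by
      ext <;> simp [Pi.single_neg]
    rw [e, map_neg] at h2
    exact le_antisymm (by linarith) h1
  have hquad : ∀ j (z : D → ℝ), 0 ≤ ∑ x, ∑ y, z x * (a x y * diffMatrix D j x y) * z y +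
      s j * ∑ x, b x * z x ^ 2 := by
    intro j z
    -- Testing `φ` on the rank-one matrices supported on one bit j gives the dual constraints.
    let c : D × Fin n → Unit → ℝ := fun p _ => if p.2 = j then z p.1 else 0
    have hmem : ((fun p => z p.1 * diffMatrix D j p.1 p.2 * z p.2, fun x => s j * z x ^ 2) :
        (D × D → ℝ) × (D → ℝ)) ∈ sdpCone s f := by
      refine ⟨_, posSemidef_gram c, fun x y _ => ?_, fun x => le_of_eq ?_⟩
      · rw [Finset.sum_filter, Finset.sum_eq_single j]
        · simp [c, diffMatrix]
        · intro k _ hk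
          simp [c, hk]
        · simp
      · rw [Finset.sum_eq_single j]
        · simp [c, sq]
        · intro k _ hk
          simp [c, hk]
        · simp
    have h := hnn _ hmem
    rw [hrep] at h
    refine h.trans (le_of_eq ?_)
    rw [Finset.mul_sum]
    congr 1
    · exact Finset.sum_congr rfl fun x _ => Finset.sum_congr rfl fun y _ => by ring
    · exact Finset.sum_congr rfl fun x _ => by ring
  have hfin := sum_le_mul_advPM hs (f := f) (fun x y => -(a x y + a y x) / 2)
    (fun x y => by ring) (fun x y h => by simp [ha0 x y h, ha0 y x h.symm]) b hb (by
      intro j z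
      have hswap : ∑ x, ∑ y, z x * (a y x * diffMatrix D j x y) * z y =
          ∑ x, ∑ y, z x * (a x y * diffMatrix D j x y) * z y := by
        rw [Finset.sum_comm]
        refine Finset.sum_congr rfl fun x _ => Finset.sum_congr rfl fun y _ => ?_
        simp only [diffMatrix, Matrix.of_apply, ne_comm]
        ring
      have : ∑ x, ∑ y, z x * (-(a x y + a y x) / 2 * diffMatrix D j x y) * z y =
          -(∑ x, ∑ y, z x * (a x y * diffMatrix D j x y) * z y +
            ∑ x, ∑ y, z x * (a y x * diffMatrix D j x y) * z y) / 2 := by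
        simp_rw [← Finset.sum_add_distrib, neg_div, Finset.sum_div, ← Finset.sum_neg_distrib]
        exact Finset.sum_congr rfl fun x _ => Finset.sum_congr rfl fun y _ => by ring
      rw [this, hswap]
      linarith [hquad j z])
  have hsw : ∑ x, ∑ y, -(a x y + a y x) / 2 = -∑ x, ∑ y, a x y := by
    have : ∑ x, ∑ y, a y x = ∑ x, ∑ y, a x y := Finset.sum_comm
    have h2 : ∑ x, ∑ y, -(a x y + a y x) / 2 =
        -(∑ x, ∑ y, a x y + ∑ x, ∑ y, a y x) / 2 := by
      simp_rw [← Finset.sum_add_distrib, neg_div, Finset.sum_div, ← Finset.sum_neg_distrib]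
    rw [h2, this]
    ring
  rw [hsw] at hfin
  rw [hrep] at hu
  simp only [one_mul, ← Finset.mul_sum] at hu
  linarith

/-- The objective does not control the bits of cost zero, so a minimizing sequence may be unbounded
there. Those bits are erased before passing to a limit. The constraints this spoils are restored
afterwards at no cost by `exists_posSemidef_prescribed`. -/
theorem exists_isSDPFeasible_of_mem_closure {s : Fin n → ℝ} (hs : ∀ j, 0 ≤ s j) (f : D → Bool)
    {v : ℝ} (hv : 0 ≤ v)
    (h : ((fun _ => 1, fun _ => v) : (D × D → ℝ) × (D → ℝ)) ∈ closure (sdpCone s f)) :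
    ∃ X, IsSDPFeasible f X ∧ sdpObjective s X ≤ v := by
  classical
  obtain ⟨p, hp, hlim⟩ := mem_closure_iff_seq_limit.mp h
  choose X hX hX1 hX2 using hp
  have hlim1 : ∀ x y, Tendsto (fun k => (p k).1 (x, y)) atTop (𝓝 1) := fun x y =>
    ((continuous_apply (x, y)).comp continuous_fst).continuousAt.tendsto.comp hlim
  have hlim2 : ∀ x, Tendsto (fun k => (p k).2 x) atTop (𝓝 v) := fun x =>
    ((continuous_apply x).comp continuous_snd).continuousAt.tendsto.comp hlim
  let J : Finset (Fin n) := {j | s j = 0}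
  let m : D × Fin n → ℝ := fun q => if q.2 ∈ J then 0 else 1
  let Y : ℕ → D × Fin n → D × Fin n → ℝ := fun k q r => m q * X k q r * m r
  have hY : ∀ k, (Matrix.of (Y k)).PosSemidef := by
    intro k
    have := (posSemidef_real_iff _).mp (hX k)
    refine (posSemidef_real_iff _).mpr ⟨fun q r => ?_, fun z => ?_⟩
    · simp only [Y, Matrix.of_apply, this.1 q r]
      ring
    · refine (this.2 fun q => z q * m q).trans (le_of_eq ?_)
      refine Finset.sum_congr rfl fun q _ => Finset.sum_congr rfl fun r _ => ?_
      simp only [Y, Matrix.of_apply]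
      ring
  have hYobj : ∀ k x, ∑ j, s j * Y k (x, j) (x, j) ≤ (p k).2 x := by
    intro k x
    refine le_trans (le_of_eq (Finset.sum_congr rfl fun j _ => ?_)) (hX2 k x)
    by_cases hj : s j = 0 <;> simp [Y, m, J, hj]
  have hYsum : ∀ k x y, f x ≠ f y → (¬∃ j ∈ J, x.1 j ≠ y.1 j) →
      ∑ j with x.1 j ≠ y.1 j, Y k (x, j) (y, j) = (p k).1 (x, y) := by
    intro k x y hxy hJ
    rw [← hX1 k x y hxy]
    refine Finset.sum_congr rfl fun j hj => ?_
    have : j ∉ J := fun hjJ => hJ ⟨j, hjJ, (Finset.mem_filter.mp hj).2⟩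
    simp [Y, m, this]
  have hbdd : ∃ R : ℝ, 0 ≤ R ∧ ∀ k x, (p k).2 x ≤ R := by
    choose R hR using fun x => (hlim2 x).bddAbove_range
    refine ⟨∑ x, |R x|, Finset.sum_nonneg fun _ _ => abs_nonneg _, fun k x => ?_⟩
    refine ((hR x ⟨k, rfl⟩).trans (le_abs_self _)).trans ?_
    exact Finset.single_le_sum (f := fun x => |R x|) (fun _ _ => abs_nonneg _) (Finset.mem_univ x)
  obtain ⟨R, hR0, hR⟩ := hbdd
  -- Bits with `s j = 0` contribute `R / 0 = 0`; the erased diagonal entries vanish there as well.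
  let M : ℝ := ∑ j, R / s j
  have hM : ∀ j, R / s j ≤ M := fun j =>
    Finset.single_le_sum (f := fun j => R / s j) (fun j _ => div_nonneg hR0 (hs j))
      (Finset.mem_univ j)
  have hM0 : 0 ≤ M := Finset.sum_nonneg fun j _ => div_nonneg hR0 (hs j)
  have hdiag : ∀ k q, Y k q q ≤ M := by
    rintro k ⟨x, j⟩
    by_cases hj : s j = 0
    · simpa [Y, m, J, hj] using hM0
    · have hpos : 0 < s j := lt_of_le_of_ne (hs j) (Ne.symm hj)
      refine le_trans ?_ (hM j)
      rw [le_div_iff₀ hpos, mul_comm]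
      refine le_trans ?_ ((hYobj k x).trans (hR k x))
      exact Finset.single_le_sum (f := fun j => s j * Y k (x, j) (x, j))
        (fun j _ => mul_nonneg (hs j) (hY k).diag_nonneg) (Finset.mem_univ j)
  have hmem : ∀ k, Y k ∈ Set.univ.pi fun _ => Set.univ.pi fun _ => Set.Icc (-M) M := by
    intro k q _ r _
    have h1 : |Y k q r| ≤ (Y k q q + Y k r r) / 2 := abs_apply_le_of_posSemidef (hY k) q r
    exact abs_le.mp (h1.trans (by linarith [hdiag k q, hdiag k r]))
  obtain ⟨Z, -, φ, hφ, hZ⟩ :=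
    (isCompact_univ_pi fun _ => isCompact_univ_pi fun _ => isCompact_Icc).tendsto_subseq hmem
  have hZ' : ∀ q r, Tendsto (fun k => Y (φ k) q r) atTop (𝓝 (Z q r)) := fun q r =>
    tendsto_pi_nhds.mp (tendsto_pi_nhds.mp hZ q) r
  have hZpsd : (Matrix.of Z).PosSemidef := by
    refine (posSemidef_real_iff _).mpr ⟨fun q r => ?_, fun z => ?_⟩
    · refine tendsto_nhds_unique (hZ' q r) ((hZ' r q).congr fun k => ?_)
      exact ((posSemidef_real_iff _).mp (hY (φ k))).1 r q
    · refine ge_of_tendsto' (tendsto_finsetSum _ fun q _ => tendsto_finsetSum _ fun r _ =>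
        ((hZ' q r).const_mul (z q)).mul_const (z r)) fun k => ?_
      exact ((posSemidef_real_iff _).mp (hY (φ k))).2 z
  have hZobj : ∀ x, ∑ j, s j * Z (x, j) (x, j) ≤ v := fun x =>
    le_of_tendsto_of_tendsto' (tendsto_finsetSum _ fun j _ => (hZ' (x, j) (x, j)).const_mul (s j))
      ((hlim2 x).comp hφ.tendsto_atTop) fun k => hYobj (φ k) x
  have hZsum : ∀ x y, f x ≠ f y → (¬∃ j ∈ J, x.1 j ≠ y.1 j) →
      ∑ j with x.1 j ≠ y.1 j, Z (x, j) (y, j) = 1 := fun x y hxy hJ =>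
    tendsto_nhds_unique ((tendsto_finsetSum _ fun j _ => hZ' (x, j) (y, j)).congr
      fun k => hYsum (φ k) x y hxy hJ) ((hlim1 x y).comp hφ.tendsto_atTop)
  obtain ⟨W, hW, hWdiag, hWsum⟩ := exists_posSemidef_prescribed f J
    (fun x y => 1 - ∑ j with x.1 j ≠ y.1 j, Z (x, j) (y, j)) (fun x y => by
      simp only [ne_comm (a := x.1 _)]
      congr 1
      exact Finset.sum_congr rfl fun j _ => ((posSemidef_real_iff _).mp hZpsd).1 (x, j) (y, j))
  refine ⟨Matrix.of Z + W, ⟨hZpsd.add hW, fun x y hxy => ?_⟩, Real.iSup_le (fun x => ?_) hv⟩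
  · simp only [Matrix.add_apply, Matrix.of_apply, Finset.sum_add_distrib, hWsum x y hxy]
    split_ifs with hJ
    · ring
    · rw [hZsum x y hxy hJ, add_zero]
  · refine le_trans (le_of_eq (Finset.sum_congr rfl fun j _ => ?_)) (hZobj x)
    by_cases hj : s j = 0
    · simp [hj]
    · simp [hWdiag x j (by simp [J, hj])]

/-- Strong duality, with attainment. -/
theorem exists_isSDPFeasible_le_advPM {s : Fin n → ℝ} (hs : ∀ j, 0 ≤ s j) (f : D → Bool) :
    ∃ X, IsSDPFeasible f X ∧ sdpObjective s X ≤ advPM s f :=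
  exists_isSDPFeasible_of_mem_closure hs f (advPM_nonneg s f) (advPM_mem_closure_sdpCone hs f)

theorem exists_isSDPOptimal {s : Fin n → ℝ} (hs : ∀ j, 0 ≤ s j) (f : D → Bool) :
    ∃ X, IsSDPOptimal s f X := by
  obtain ⟨X, hX, h⟩ := exists_isSDPFeasible_le_advPM hs f
  exact ⟨X, hX, fun Y hY => h.trans (advPM_le_sdpObjective hs hY)⟩

theorem IsSDPOptimal.sdpObjective_le_advPM {s : Fin n → ℝ} (hs : ∀ j, 0 ≤ s j) {f : D → Bool}
    {X : Matrix (D × Fin n) (D × Fin n) ℝ} (hX : IsSDPOptimal s f X) :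
    sdpObjective s X ≤ advPM s f := by
  obtain ⟨Y, hY, h⟩ := exists_isSDPFeasible_le_advPM hs f
  exact (hX.2 Y hY).trans h

theorem exists_isCholesky {X : Matrix (D × Fin n) (D × Fin n) ℝ} (hX : X.PosSemidef) :
    ∃ (m : ℕ) (c : D → Fin n → EuclideanSpace ℝ (Fin m)), IsCholesky X c := by
  obtain ⟨c, hc⟩ := exists_gram_of_posSemidef hX
  let e := Fintype.equivFin (D × Fin n)
  refine ⟨_, fun x j => WithLp.toLp 2 fun k => c (x, j) (e.symm k), fun x j y k => ?_⟩
  rw [hc, ← Equiv.sum_comp e.symm, PiLp.inner_apply]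
  exact Finset.sum_congr rfl fun i _ => by simp [mul_comm]

end StrongDuality

/-! ### Witnesses, and the lower bound for arbitrary span programs. -/

namespace SpanProgram

variable {n : ℕ}

theorem fn_eq_true_iff (P : SpanProgram.{u, v} n) (x : Fin n → Bool) :
    P.fn x = true ↔ ∃ w, P.IsPosWitness x w := by
  classical
  rw [fn, decide_eq_true_iff, Submodule.mem_span_image_iff_exists_fun]
  constructor
  · rintro ⟨t, ht, c, hc⟩
    refine ⟨fun i => if h : i ∈ t then c ⟨i, h⟩ else 0, ?_⟩
    rw [IsPosWitness, ← hc, ← Finset.sum_subset (Finset.subset_univ t)]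
    · rw [← Finset.sum_coe_sort]
      refine Finset.sum_congr rfl fun i _ => ?_
      rw [if_pos (ht i.2), dif_pos i.2]
    · intro i _ hi
      simp [hi]
  · rintro ⟨w, hw⟩
    refine ⟨({i | i ∈ P.available x} : Finset P.I), by simp, fun i => w i, ?_⟩
    rw [← hw, Finset.sum_coe_sort _ (fun i => w i • P.vec i), Finset.sum_filter]
    exact Finset.sum_congr rfl fun i _ => by split_ifs <;> simp

theorem IsPosWitness.inner_target {P : SpanProgram.{u, v} n} {x : Fin n → Bool} {w : P.I → ℂ}
    (hw : P.IsPosWitness x w) (w' : P.V) [DecidablePred (· ∈ P.available x)] :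
    inner ℂ P.target w' =
      ∑ i, if i ∈ P.available x then starRingEnd ℂ (w i) * inner ℂ (P.vec i) w' else 0 := by
  rw [← hw, sum_inner]
  refine Finset.sum_congr rfl fun i _ => ?_
  rw [inner_smul_left]
  split_ifs <;> simp

theorem IsNegWitness.fn_eq_false {P : SpanProgram.{u, v} n} {x : Fin n → Bool} {w' : P.V}
    (hw' : P.IsNegWitness x w') : P.fn x = false := by
  classical
  by_contra h
  obtain ⟨w, hw⟩ := (P.fn_eq_true_iff x).mp (by simpa using h)
  have h1 := hw.inner_target w'
  rw [hw'.1, Finset.sum_eq_zero] at h1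
  · exact one_ne_zero h1
  · intro i _
    split_ifs with hi
    · rw [hw'.2 i hi, mul_zero]
    · rfl

/-- The witness is the component of the target orthogonal to the available vectors, normalized. -/
theorem exists_isNegWitness {P : SpanProgram.{u, v} n} {x : Fin n → Bool}
    (h : P.fn x = false) : ∃ w', P.IsNegWitness x w' := by
  classical
  set K := Submodule.span ℂ (P.vec '' P.available x)
  have ht : P.target ∉ K := by simpa [fn] using h
  set z := P.target - K.starProjection P.target
  have hz : z ∈ Kᗮ := K.sub_starProjection_mem_orthogonal P.target
  have hz0 : z ≠ 0 := by
    intro h0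
    refine ht ?_
    rw [sub_eq_zero.mp h0]
    exact K.starProjection_apply_mem _
  have e : inner ℂ P.target z = inner ℂ z z := by
    conv_lhs => rw [← sub_add_cancel P.target (K.starProjection P.target)]
    rw [inner_add_left, Submodule.inner_right_of_mem_orthogonal (K.starProjection_apply_mem _) hz,
      add_zero]
  have hne : inner ℂ P.target z ≠ (0 : ℂ) := by rwa [e, inner_self_ne_zero]
  refine ⟨(inner ℂ P.target z)⁻¹ • z, ?_, fun i hi => ?_⟩
  · rw [inner_smul_right, inv_mul_cancel₀ hne]
  · rw [inner_smul_right, Submodule.inner_right_of_mem_orthogonal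
      (Submodule.subset_span (Set.mem_image_of_mem _ hi)) hz, mul_zero]

variable {s : Fin n → ℝ}

theorem cost_nonneg (hs : ∀ j, 0 ≤ s j) (P : SpanProgram.{u, v} n) (i : P.I) :
    0 ≤ P.cost s i := by
  unfold cost
  split
  exacts [le_rfl, hs _]

theorem cost_eq_sum (P : SpanProgram.{u, v} n) (i : P.I) :
    P.cost s i = ∑ j, if ∃ β, P.label i = some (j, β) then s j else 0 := by
  unfold cost
  rcases h : P.label i with _ | ⟨j, β⟩
  · simp
  · simp

theorem sum_cost_nonneg (hs : ∀ j, 0 ≤ s j) (P : SpanProgram.{u, v} n) (w : P.I → ℂ) :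
    0 ≤ ∑ i, P.cost s i * ‖w i‖ ^ 2 :=
  Finset.sum_nonneg fun i _ => mul_nonneg (P.cost_nonneg hs i) (sq_nonneg _)

theorem wsizeAt_nonneg (hs : ∀ j, 0 ≤ s j) (P : SpanProgram.{u, v} n) (x : Fin n → Bool) :
    0 ≤ P.wsizeAt s x := by
  unfold wsizeAt
  split_ifs
  all_goals
    refine Real.sInf_nonneg ?_
    rintro _ ⟨w, -, rfl⟩
    exact P.sum_cost_nonneg hs _

theorem IsPosWitness.wsizeAt_le (hs : ∀ j, 0 ≤ s j) {P : SpanProgram.{u, v} n}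
    {x : Fin n → Bool} {w : P.I → ℂ} (hw : P.IsPosWitness x w) :
    P.wsizeAt s x ≤ ∑ i, P.cost s i * ‖w i‖ ^ 2 := by
  rw [wsizeAt, if_pos ((P.fn_eq_true_iff x).mpr ⟨w, hw⟩)]
  refine csInf_le ⟨0, ?_⟩ ⟨w, hw, rfl⟩
  rintro _ ⟨w, -, rfl⟩
  exact P.sum_cost_nonneg hs _

theorem IsNegWitness.wsizeAt_le (hs : ∀ j, 0 ≤ s j) {P : SpanProgram.{u, v} n}
    {x : Fin n → Bool} {w' : P.V} (hw : P.IsNegWitness x w') :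
    P.wsizeAt s x ≤ ∑ i, P.cost s i * ‖(inner ℂ (P.vec i) w' : ℂ)‖ ^ 2 := by
  rw [wsizeAt, if_neg (by simp [hw.fn_eq_false])]
  refine csInf_le ⟨0, ?_⟩ ⟨w', hw, rfl⟩
  rintro _ ⟨w, -, rfl⟩
  exact P.sum_cost_nonneg hs _

theorem exists_isPosWitness_lt {P : SpanProgram.{u, v} n} {x : Fin n → Bool}
    (h : P.fn x = true) {ε : ℝ} (hε : 0 < ε) :
    ∃ w, P.IsPosWitness x w ∧ ∑ i, P.cost s i * ‖w i‖ ^ 2 < P.wsizeAt s x + ε := by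
  obtain ⟨w, hw⟩ := (P.fn_eq_true_iff x).mp h
  rw [wsizeAt, if_pos h]
  obtain ⟨_, ⟨w, hw, rfl⟩, hlt⟩ := Real.lt_sInf_add_pos
    (s := {r | ∃ w, P.IsPosWitness x w ∧ r = ∑ i, P.cost s i * ‖w i‖ ^ 2}) ⟨_, w, hw, rfl⟩ hε
  exact ⟨w, hw, hlt⟩

theorem exists_isNegWitness_lt {P : SpanProgram.{u, v} n} {x : Fin n → Bool}
    (h : P.fn x = false) {ε : ℝ} (hε : 0 < ε) :
    ∃ w', P.IsNegWitness x w' ∧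
      ∑ i, P.cost s i * ‖(inner ℂ (P.vec i) w' : ℂ)‖ ^ 2 < P.wsizeAt s x + ε := by
  obtain ⟨w, hw⟩ := exists_isNegWitness h
  rw [wsizeAt, if_neg (by simp [h])]
  obtain ⟨_, ⟨w, hw, rfl⟩, hlt⟩ := Real.lt_sInf_add_pos
    (s := {r | ∃ w', P.IsNegWitness x w' ∧
      r = ∑ i, P.cost s i * ‖(inner ℂ (P.vec i) w' : ℂ)‖ ^ 2}) ⟨_, w, hw, rfl⟩ hε
  exact ⟨w, hw, hlt⟩

/-- The vectors that approximately optimal witnesses give: on the positive inputs they are the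
available parts of the witnesses `w`, and on the negative inputs they are the vectors `A† w'`. -/
theorem exists_witness_vector {P : SpanProgram.{u, v} n} (hs : ∀ j, 0 ≤ s j) (x : Fin n → Bool)
    {ε : ℝ} (hε : 0 < ε) :
    ∃ q : P.I → ℂ, ∑ i, P.cost s i * ‖q i‖ ^ 2 ≤ P.wsizeAt s x + ε ∧
      if P.fn x = true then
        (∀ i ∉ P.available x, q i = 0) ∧
          ∀ w' : P.V, inner ℂ P.target w' = ∑ i, starRingEnd ℂ (q i) * inner ℂ (P.vec i) w'
      else
        ∃ w', P.IsNegWitness x w' ∧ ∀ i, q i = inner ℂ (P.vec i) w' := by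
  classical
  rcases h : P.fn x with _ | _
  · obtain ⟨w', hw', hlt⟩ := exists_isNegWitness_lt (s := s) h hε
    exact ⟨fun i => inner ℂ (P.vec i) w', hlt.le, by simpa using ⟨w', hw', fun _ => rfl⟩⟩
  · obtain ⟨w, hw, hlt⟩ := exists_isPosWitness_lt (s := s) h hε
    refine ⟨fun i => if i ∈ P.available x then w i else 0, le_trans ?_ hlt.le, ?_⟩
    · refine Finset.sum_le_sum fun i _ => mul_le_mul_of_nonneg_left ?_ (P.cost_nonneg hs i)
      dsimp only
      split_ifs
      · exact le_rfl
      · simp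
    · rw [if_pos rfl]
      refine ⟨fun i hi => if_neg hi, fun w' => ?_⟩
      rw [hw.inner_target w']
      refine Finset.sum_congr rfl fun i _ => ?_
      dsimp only
      split_ifs <;> simp

/-- Any span program for `f` has witness size at least the adversary bound. -/
theorem Computes.advPM_le_wsize (hs : ∀ j, 0 ≤ s j) {D : Finset (Fin n → Bool)} {f : D → Bool}
    {P : SpanProgram.{u, v} n} (hP : P.Computes f) : advPM s f ≤ P.wsize s D := by
  classical
  -- Nearly optimal witnesses suffice, so attainment of the minima is not needed.
  refine le_of_forall_pos_le_add fun ε hε => ?_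
  have hw : ∀ x : D, P.wsizeAt s x.1 ≤ P.wsize s D := fun x =>
    le_ciSup (f := fun x : D => P.wsizeAt s x.1) (Set.finite_range _).bddAbove x
  have hw0 : 0 ≤ P.wsize s D := Real.iSup_nonneg fun x => P.wsizeAt_nonneg hs x.1
  choose q hq hq' using fun x : D => exists_witness_vector (P := P) hs x.1 hε
  -- The witness vector is cut into blocks by input bit; the Boolean index separates real and
  -- imaginary parts.
  let c : D → Fin n → P.I × Bool → ℝ := fun x j k =>
    if ∃ β, P.label k.1 = some (j, β) then (if k.2 then (q x k.1).re else (q x k.1).im) else 0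
  have hc : ∀ x y j, ∑ k, c x j k * c y j k =
      ∑ i, if ∃ β, P.label i = some (j, β) then (starRingEnd ℂ (q x i) * q y i).re else 0 := by
    intro x y j
    rw [Fintype.sum_prod_type]
    refine Finset.sum_congr rfl fun i _ => ?_
    by_cases h : ∃ β, P.label i = some (j, β) <;> simp [-Bool.exists_bool, c, h]
  have hcomm : ∀ x y j, ∑ k, c x j k * c y j k = ∑ k, c y j k * c x j k := fun x y j =>
    Finset.sum_congr rfl fun k _ => mul_comm _ _
  have hmain : ∀ x y : D, f x = true → f y = false →
      ∑ j with x.1 j ≠ y.1 j, ∑ k, c x j k * c y j k = 1 := by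
    intro x y hx hy
    have hx' := hq' x
    have hy' := hq' y
    rw [hP x, if_pos hx] at hx'
    rw [hP y, if_neg (by simp [hy])] at hy'
    obtain ⟨w', hw', hy'⟩ := hy'
    have h1 := hx'.2 w'
    rw [hw'.1] at h1
    have h2 := congrArg Complex.re h1
    rw [Complex.one_re, Complex.re_sum] at h2
    rw [h2]
    simp_rw [hc]
    rw [Finset.sum_comm]
    refine Finset.sum_congr rfl fun i _ => ?_
    rw [Finset.sum_filter, ← hy' i]
    -- `q x` vanishes at indices unavailable to x, and `q y` at those available to y. In particular
    -- free indices and bits where x and y agree contribute nothing.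
    rcases hl : P.label i with _ | ⟨j, β⟩
    · have : i ∈ P.available y.1 := Or.inl hl
      simp [hy' i, hw'.2 i this]
    · rw [Finset.sum_eq_single j]
      · by_cases hxy : x.1 j = y.1 j
        · by_cases hβ : β = x.1 j
          · have : i ∈ P.available y.1 := Or.inr ⟨j, by rw [hl, hβ, hxy]⟩
            simp [hy' i, hw'.2 i this]
          · have : i ∉ P.available x.1 := by
              simp only [available, Set.mem_ofPred_eq, hl]
              rintro (h | ⟨k, h⟩)
              · cases h
              · simp only [Option.some.injEq, Prod.mk.injEq] at h
                exact hβ (h.1 ▸ h.2)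
            simp [hx'.1 i this]
        · simp [hxy]
      · intro k _ hk
        simp [hk.symm]
      · simp
  refine advPM_le_of_vectors c (fun x y hxy => ?_) (by positivity) fun x => ?_
  · rcases hx : f x with _ | _
    · have hy : f y = true := by rw [hx] at hxy; simpa using hxy.symm
      rw [← hmain y x hy hx]
      simp_rw [hcomm x y, ne_comm]
    · exact hmain x y hx (by rw [hx] at hxy; simpa using hxy.symm)
  · refine le_trans (le_of_eq ?_) ((hq x).trans (add_le_add_left (hw x) ε))
    simp_rw [cost_eq_sum, sq (c _ _ _), hc, Finset.mul_sum, Finset.sum_mul]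
    rw [Finset.sum_comm]
    refine Finset.sum_congr rfl fun i _ => Finset.sum_congr rfl fun j _ => ?_
    split_ifs
    · rw [← Complex.normSq_eq_conj_mul_self, Complex.ofReal_re, Complex.normSq_eq_norm_sq]
    · simp

end SpanProgram

/-! ### The canonical span program of a family of vectors. -/

section VectorProgram

variable {n : ℕ} {D : Finset (Fin n → Bool)} (f : D → Bool) {m : ℕ}
  (c : D → Fin n → EuclideanSpace ℝ (Fin m))

/-- The input vectors given by the `c x j`, as functions on the negative inputs in the domain. -/
def inputVec (i : Fin n × Bool × Fin m) (z : {x : D // f x = false}) : ℝ :=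
  if z.1.1 i.1 ≠ i.2.1 then c z.1 i.1 i.2.2 else 0

/-- `w` is a real witness against the input `x`, for the all-ones target and the input vectors
`inputVec f c i`. -/
def IsRealNegWitness (x : Fin n → Bool) (w : {x : D // f x = false} → ℝ) : Prop :=
  ∑ z, w z = 1 ∧ ∀ j k, ∑ z, w z * inputVec f c (j, x j, k) z = 0

/-- Fredholm alternative over ℝ: a functional that kills the available vectors but not the all-ones
vector becomes a real witness when normalized. -/
theorem exists_combination_of_not_exists_isRealNegWitness {x : Fin n → Bool}
    (h : ¬∃ w, IsRealNegWitness f c x w) :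
    ∃ a : Fin n × Fin m → ℝ, ∀ z, ∑ i, a i * inputVec f c (i.1, x i.1, i.2) z = 1 := by
  classical
  let g : Fin n × Fin m → {x : D // f x = false} → ℝ := fun i => inputVec f c (i.1, x i.1, i.2)
  have hmem : (fun _ => 1) ∈ Submodule.span ℝ (Set.range g) := by
    by_contra hnot
    obtain ⟨φ, hφ, hle⟩ := Submodule.exists_le_ker_of_notMem hnot
    have hrep : ∀ u : {x : D // f x = false} → ℝ,
        φ u = ∑ z, u z * φ (fun y => if z = y then 1 else 0) := fun u => by
      simpa using LinearMap.pi_apply_eq_sum_univ φ u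
    refine h ⟨fun z => φ (fun y => if z = y then 1 else 0) / φ (fun _ => 1), ?_, fun j k => ?_⟩
    · rw [← Finset.sum_div, div_eq_one_iff_eq hφ, hrep fun _ => 1]
      simp
    · have h0 : φ (g (j, k)) = 0 := hle (Submodule.subset_span ⟨(j, k), rfl⟩)
      rw [hrep (g (j, k))] at h0
      simp_rw [div_mul_eq_mul_div]
      rw [← Finset.sum_div, div_eq_zero_iff]
      exact Or.inl ((Finset.sum_congr rfl fun z _ => mul_comm _ _).trans h0)
  obtain ⟨a, ha⟩ := (Submodule.mem_span_range_iff_exists_fun ℝ).mp hmem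
  exact ⟨a, fun z => by simpa [g] using congrFun ha z⟩

open Classical in
/-- A real witness against each rejected input, which for the negative inputs in the domain is the
corresponding coordinate functional. -/
noncomputable def realNegWitness (x : {x // ∃ w, IsRealNegWitness f c x w}) :
    {x : D // f x = false} → ℝ :=
  if h : ∃ hx : x.1 ∈ D, f ⟨x.1, hx⟩ = false then Pi.single ⟨⟨x.1, h.1⟩, h.2⟩ 1 else x.2.choose

theorem isRealNegWitness_single [DecidableEq {x : D // f x = false}]
    (z : {x : D // f x = false}) : IsRealNegWitness f c z.1.1 (Pi.single z 1) := by
  constructor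
  · simp
  · intro j k
    rw [Finset.sum_eq_single z (fun y _ hy => by simp [hy]) (by simp)]
    simp [inputVec]

theorem realNegWitness_of_mem [DecidableEq {x : D // f x = false}]
    (x : {x // ∃ w, IsRealNegWitness f c x w}) (z : {x : D // f x = false}) (h : z.1.1 = x.1) :
    realNegWitness f c x = Pi.single z 1 := by
  obtain ⟨x, hw⟩ := x
  subst h
  rw [realNegWitness, dif_pos ⟨z.1.2, z.2⟩]
  congr!

theorem realNegWitness_spec (x : {x // ∃ w, IsRealNegWitness f c x w}) :
    IsRealNegWitness f c x.1 (realNegWitness f c x) := by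
  classical
  by_cases h : ∃ hx : x.1 ∈ D, f ⟨x.1, hx⟩ = false
  · rw [realNegWitness_of_mem f c x ⟨⟨x.1, h.1⟩, h.2⟩ rfl]
    exact isRealNegWitness_single f c ⟨⟨x.1, h.1⟩, h.2⟩
  · rw [realNegWitness, dif_neg h]
    exact x.2.choose_spec

/-- The coordinates of the input vectors of the canonical span program built from `c`, indexed by
all inputs that it rejects. -/
noncomputable def canonicalCoord (i : Fin n × Bool × Fin m)
    (x : {x // ∃ w, IsRealNegWitness f c x w}) : ℝ :=
  ∑ z, realNegWitness f c x z * inputVec f c i z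

theorem canonicalCoord_eq_zero (x : {x // ∃ w, IsRealNegWitness f c x w}) (j : Fin n) (k : Fin m) :
    canonicalCoord f c (j, x.1 j, k) x = 0 :=
  (realNegWitness_spec f c x).2 j k

theorem canonicalCoord_of_mem (i : Fin n × Bool × Fin m)
    (x : {x // ∃ w, IsRealNegWitness f c x w}) (z : {x : D // f x = false}) (h : z.1.1 = x.1) :
    canonicalCoord f c i x = inputVec f c i z := by
  classical
  rw [canonicalCoord, realNegWitness_of_mem f c x z h]
  simp [Pi.single_apply]

noncomputable instance : Fintype {x // ∃ w, IsRealNegWitness f c x w} := Fintype.ofFinite _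

/-- The canonical span program built from the vectors `c x j`. -/
noncomputable abbrev canonicalProgram : SpanProgram.{u, v} n where
  V := EuclideanSpace ℂ (ULift.{u} {x // ∃ w, IsRealNegWitness f c x w})
  target := WithLp.toLp 2 fun _ => 1
  I := ULift.{v} (Fin n × Bool × Fin m)
  vec i := WithLp.toLp 2 fun x => (canonicalCoord f c i.down x.down : ℂ)
  label i := some (i.down.1, i.down.2.1)

theorem mem_available_canonicalProgram {x : Fin n → Bool} {i : (canonicalProgram.{u, v} f c).I} :
    i ∈ (canonicalProgram.{u, v} f c).available x ↔ i.down.2.1 = x i.down.1 := by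
  simp only [SpanProgram.available, canonicalProgram]
  constructor
  · rintro (h | ⟨j, h⟩)
    · cases h
    · simp only [Option.some.injEq, Prod.mk.injEq] at h
      rw [h.2, h.1]
  · intro h
    exact Or.inr ⟨i.down.1, by rw [h]⟩

open Classical in
theorem inner_single_canonicalProgram (i : (canonicalProgram.{u, v} f c).I)
    (x : ULift.{u} {x // ∃ w, IsRealNegWitness f c x w}) :
    inner ℂ ((canonicalProgram.{u, v} f c).vec i)
      (EuclideanSpace.single x 1 : EuclideanSpace ℂ _) = (canonicalCoord f c i.down x.down : ℂ) := by
  change inner ℂ (WithLp.toLp 2 fun x => (canonicalCoord f c i.down x.down : ℂ) :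
    EuclideanSpace ℂ (ULift.{u} {x // ∃ w, IsRealNegWitness f c x w})) _ = _
  rw [EuclideanSpace.inner_single_right]
  simp

open Classical in
theorem isNegWitness_canonicalProgram (x : {x // ∃ w, IsRealNegWitness f c x w}) :
    (canonicalProgram.{u, v} f c).IsNegWitness x.1
      (EuclideanSpace.single (ULift.up x) 1 : EuclideanSpace ℂ _) := by
  constructor
  · change inner ℂ (WithLp.toLp 2 fun _ => 1 : EuclideanSpace ℂ _) _ = _
    rw [EuclideanSpace.inner_single_right]
    simp
  · rintro ⟨j, β, k⟩ hi
    rw [mem_available_canonicalProgram] at hi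
    rw [inner_single_canonicalProgram]
    obtain rfl : β = x.1 j := hi
    rw [canonicalCoord_eq_zero, Complex.ofReal_zero]

theorem sum_ite_bool {M : Type*} [AddCommMonoid M] {n m : ℕ} (β : Fin n → Bool)
    (g : Fin n × Fin m → M) :
    ∑ i : Fin n × Bool × Fin m, (if i.2.1 = β i.1 then g (i.1, i.2.2) else 0) = ∑ p, g p := by
  simp_rw [Fintype.sum_prod_type]
  refine Finset.sum_congr rfl fun j _ => ?_
  rw [Finset.sum_eq_single (β j) (fun b _ hb => by simp [hb]) (by simp)]
  simp

/-- Each coordinate is a combination, with coefficients summing to 1, of the coordinates at negative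
inputs in `D`. Hence a combination equal to 1 at the latter equals 1 at all of them. -/
theorem isPosWitness_canonicalProgram {x : Fin n → Bool} {a : Fin n × Fin m → ℝ}
    (ha : ∀ z, ∑ i, a i * inputVec f c (i.1, x i.1, i.2) z = 1) :
    (canonicalProgram.{u, v} f c).IsPosWitness x fun i =>
      if i.down.2.1 = x i.down.1 then (a (i.down.1, i.down.2.2) : ℂ) else 0 := by
  classical
  have hreal : ∀ y : {x // ∃ w, IsRealNegWitness f c x w},
      ∑ i : Fin n × Fin m, a i * canonicalCoord f c (i.1, x i.1, i.2) y = 1 := by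
    intro y
    simp_rw [canonicalCoord, Finset.mul_sum]
    rw [Finset.sum_comm, ← (realNegWitness_spec f c y).1]
    refine Finset.sum_congr rfl fun z _ => ?_
    calc _ = realNegWitness f c y z * ∑ i, a i * inputVec f c (i.1, x i.1, i.2) z := by
          rw [Finset.mul_sum]
          exact Finset.sum_congr rfl fun i _ => by ring
      _ = _ := by rw [ha, mul_one]
  have hterm : ∀ i : (canonicalProgram.{u, v} f c).I,
      (if i ∈ (canonicalProgram.{u, v} f c).available x then
        (if i.down.2.1 = x i.down.1 then (a (i.down.1, i.down.2.2) : ℂ) else 0) else 0) =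
      if i.down.2.1 = x i.down.1 then (a (i.down.1, i.down.2.2) : ℂ) else 0 := fun i => by
    by_cases h : i.down.2.1 = x i.down.1
    · rw [if_pos ((mem_available_canonicalProgram f c).mpr h)]
    · simp [h]
  refine (Finset.sum_congr rfl fun i _ => congrArg (· • _) (by convert hterm i)).trans ?_
  ext y
  simp only [WithLp.ofLp_sum, Finset.sum_apply, PiLp.smul_apply, smul_eq_mul]
  refine (Equiv.ulift.symm.sum_comp _).symm.trans ?_
  rw [← Complex.ofReal_one, ← hreal y.down, Complex.ofReal_sum,
    ← sum_ite_bool x fun p => ((a p * canonicalCoord f c (p.1, x p.1, p.2) y.down : ℝ) : ℂ)]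
  refine Finset.sum_congr rfl fun ⟨j, β, k⟩ _ => ?_
  change (if β = x j then (a (j, k) : ℂ) else 0) * (canonicalCoord f c (j, β, k) y.down : ℂ) = _
  split_ifs with h
  · simp [h]
  · simp

/-- This resolves the circularity in the canonical form: the coordinates, fixed in advance by the
existence of real witnesses, are indexed exactly by the rejected inputs. -/
theorem canonicalProgram_fn_eq_false_iff (x : Fin n → Bool) :
    (canonicalProgram.{u, v} f c).fn x = false ↔ ∃ w, IsRealNegWitness f c x w := by
  classical
  refine ⟨fun h => ?_, fun h => (isNegWitness_canonicalProgram f c ⟨x, h⟩).fn_eq_false⟩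
  by_contra hw
  obtain ⟨a, ha⟩ := exists_combination_of_not_exists_isRealNegWitness f c hw
  rw [((canonicalProgram.{u, v} f c).fn_eq_true_iff x).mpr
    ⟨_, isPosWitness_canonicalProgram f c ha⟩] at h
  cases h

/-- The standard basis of the space of `canonicalProgram`, indexed by the rejected inputs. -/
noncomputable def canonicalBasis :
    OrthonormalBasis {x : Fin n → Bool // (canonicalProgram.{u, v} f c).fn x = false} ℂ
      (canonicalProgram.{u, v} f c).V :=
  (EuclideanSpace.basisFun (ULift.{u} {x // ∃ w, IsRealNegWitness f c x w}) ℂ).reindex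
    (Equiv.ulift.trans
      (Equiv.subtypeEquivRight fun x => (canonicalProgram_fn_eq_false_iff f c x).symm))

theorem canonicalBasis_repr (v : (canonicalProgram.{u, v} f c).V)
    (x : {x : Fin n → Bool // (canonicalProgram.{u, v} f c).fn x = false}) :
    (canonicalBasis f c).repr v x = (show EuclideanSpace ℂ _ from v)
      (ULift.up ⟨x.1, (canonicalProgram_fn_eq_false_iff f c x.1).mp x.2⟩) := by
  rw [canonicalBasis, OrthonormalBasis.repr_reindex]
  rfl

theorem isCanonicalIn_canonicalProgram :
    (canonicalProgram.{u, v} f c).IsCanonicalIn (canonicalBasis f c) := by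
  classical
  refine ⟨fun i => by simp, ?_, ?_⟩
  · rw [← (canonicalBasis f c).sum_repr (canonicalProgram.{u, v} f c).target]
    refine Finset.sum_congr rfl fun x _ => ?_
    rw [canonicalBasis_repr]
    exact one_smul _ _
  · rintro x j ⟨j', β, k⟩ h
    have h' : j' = j ∧ β = x.1 j := by simpa using h
    obtain ⟨rfl, rfl⟩ := h'
    rw [← (canonicalBasis f c).repr_apply_apply, canonicalBasis_repr]
    change ((canonicalCoord f c _ _ : ℝ) : ℂ) = 0
    rw [Complex.ofReal_eq_zero]
    exact canonicalCoord_eq_zero f c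
      ⟨x.1, (canonicalProgram_fn_eq_false_iff f c x.1).mp x.2⟩ j' k

theorem isRealIn_canonicalProgram :
    (canonicalProgram.{u, v} f c).IsRealIn (canonicalBasis f c).toBasis := by
  refine ⟨fun x => ?_, fun i x => ?_⟩
  · rw [OrthonormalBasis.coe_toBasis_repr_apply, canonicalBasis_repr]
    exact Complex.one_im
  · rw [OrthonormalBasis.coe_toBasis_repr_apply, canonicalBasis_repr]
    exact Complex.ofReal_im _

theorem isBuiltFrom_canonicalProgram :
    IsBuiltFrom f c (canonicalProgram.{u, v} f c) (canonicalBasis f c) := by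
  refine ⟨Equiv.ulift.symm, fun j β k => rfl, fun x hx hfx j β k => ?_⟩
  rw [canonicalBasis_repr]
  have h := canonicalCoord_of_mem f c (j, β, k)
    ⟨x.1, (canonicalProgram_fn_eq_false_iff f c x.1).mp hx⟩ ⟨x, hfx⟩ rfl
  change ((canonicalCoord f c (j, β, k) _ : ℝ) : ℂ) = _
  rw [h, inputVec]
  split_ifs <;> simp

variable {f c}

/-- At `z`, a vector available to `y` is nonzero only for bits where the two inputs differ, so the
sum is the constraint of the semi-definite program. -/
theorem sum_mul_inputVec_eq_one
    (hc : ∀ x y : D, f x ≠ f y → ∑ j with x.1 j ≠ y.1 j, inner ℝ (c x j) (c y j) = 1)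
    {y : D} (hy : f y = true) (z : {x : D // f x = false}) :
    ∑ i : Fin n × Fin m, c y i.1 i.2 * inputVec f c (i.1, y.1 i.1, i.2) z = 1 := by
  rw [← hc z.1 y (by simp [z.2, hy]), Finset.sum_filter, Fintype.sum_prod_type]
  refine Finset.sum_congr rfl fun j _ => ?_
  split_ifs with h
  · rw [PiLp.inner_apply]
    exact Finset.sum_congr rfl fun k _ => by simp [inputVec, h]
  · simp [inputVec, h]

theorem computes_canonicalProgram
    (hc : ∀ x y : D, f x ≠ f y → ∑ j with x.1 j ≠ y.1 j, inner ℝ (c x j) (c y j) = 1) :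
    (canonicalProgram.{u, v} f c).Computes f := by
  classical
  intro x
  rcases hx : f x with _ | _
  · exact (canonicalProgram_fn_eq_false_iff f c x.1).mpr ⟨_, isRealNegWitness_single f c ⟨x, hx⟩⟩
  · exact (SpanProgram.fn_eq_true_iff _ _).mpr
      ⟨_, isPosWitness_canonicalProgram f c (sum_mul_inputVec_eq_one hc hx)⟩

/-- `β` selects the one block per bit that carries the witness vector: x itself for positive inputs,
its complement for negative ones. -/
theorem sum_cost_canonicalProgram_le {s : Fin n → ℝ} (hs : ∀ j, 0 ≤ s j) (x : D)
    (w : (canonicalProgram.{u, v} f c).I → ℂ) (β : Fin n → Bool)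
    (hw : ∀ i, i.down.2.1 = β i.down.1 → ‖w i‖ ≤ |c x i.down.1 i.down.2.2|)
    (hw0 : ∀ i, i.down.2.1 ≠ β i.down.1 → w i = 0) :
    ∑ i, (canonicalProgram.{u, v} f c).cost s i * ‖w i‖ ^ 2 ≤ ∑ j, s j * ‖c x j‖ ^ 2 := by
  have h : ∑ j, s j * ‖c x j‖ ^ 2 = ∑ p : Fin n × Fin m, s p.1 * c x p.1 p.2 ^ 2 := by
    rw [Fintype.sum_prod_type]
    exact Finset.sum_congr rfl fun j _ => by rw [EuclideanSpace.real_norm_sq_eq, Finset.mul_sum]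
  rw [h, ← sum_ite_bool β]
  refine ((Equiv.ulift.symm.sum_comp _).symm).le.trans (Finset.sum_le_sum fun ⟨j, b, k⟩ _ => ?_)
  change s j * ‖w (ULift.up (j, b, k))‖ ^ 2 ≤ if b = β j then s j * c x j k ^ 2 else 0
  split_ifs with hb
  · refine mul_le_mul_of_nonneg_left ?_ (hs j)
    rw [← sq_abs (c x j k)]
    exact pow_le_pow_left₀ (norm_nonneg _) (hw ⟨j, b, k⟩ hb) 2
  · simp [hw0 ⟨j, b, k⟩ hb]

theorem wsizeAt_canonicalProgram_le
    (hc : ∀ x y : D, f x ≠ f y → ∑ j with x.1 j ≠ y.1 j, inner ℝ (c x j) (c y j) = 1)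
    {s : Fin n → ℝ} (hs : ∀ j, 0 ≤ s j) (x : D) :
    (canonicalProgram.{u, v} f c).wsizeAt s x.1 ≤ ∑ j, s j * ‖c x j‖ ^ 2 := by
  classical
  rcases hx : f x with _ | _
  · have hr : ∃ w, IsRealNegWitness f c x.1 w := ⟨_, isRealNegWitness_single f c ⟨x, hx⟩⟩
    refine ((isNegWitness_canonicalProgram f c ⟨x.1, hr⟩).wsizeAt_le hs).trans ?_
    refine sum_cost_canonicalProgram_le hs x _ (fun j => !x.1 j) (fun i hi => ?_) fun i hi => ?_
    · rw [inner_single_canonicalProgram, canonicalCoord_of_mem f c _ ⟨x.1, hr⟩ ⟨x, hx⟩ rfl]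
      simp [inputVec, hi]
    · rw [inner_single_canonicalProgram, canonicalCoord_of_mem f c _ ⟨x.1, hr⟩ ⟨x, hx⟩ rfl]
      simp only [ne_eq, Bool.not_eq_not] at hi
      simp [inputVec, hi]
  · refine ((isPosWitness_canonicalProgram f c (sum_mul_inputVec_eq_one hc hx)).wsizeAt_le hs).trans
      ?_
    refine sum_cost_canonicalProgram_le hs x _ x.1 (fun i hi => ?_) fun i hi => ?_
    · simp [hi]
    · simp [hi]

end VectorProgram

/-! ### The main theorem. -/

theorem theoremt {n : ℕ} (D : Finset (Fin n → Bool)) (f : D → Bool)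
    (s : Fin n → ℝ) (hs : ∀ j, 0 ≤ s j) :
    IsLeast {r : ℝ | ∃ P : SpanProgram.{u, v} n, P.Computes f ∧ P.wsize s D = r} (advPM s f) ∧
    (∃ X, IsSDPOptimal s f X ∧
      ∃ (m : ℕ) (c : D → Fin n → EuclideanSpace ℝ (Fin m)), IsCholesky X c) ∧
    ∀ X, IsSDPOptimal s f X →
      ∀ (m : ℕ) (c : D → Fin n → EuclideanSpace ℝ (Fin m)), IsCholesky X c →
        ∃ (P : SpanProgram.{u, v} n)
          (b : OrthonormalBasis {x : Fin n → Bool // P.fn x = false} ℂ P.V),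
          P.IsCanonicalIn b ∧ P.IsRealIn b.toBasis ∧ IsBuiltFrom f c P b ∧
          P.Computes f ∧ P.wsize s D = advPM s f := by
  have build : ∀ X, IsSDPOptimal s f X →
      ∀ (m : ℕ) (c : D → Fin n → EuclideanSpace ℝ (Fin m)), IsCholesky X c →
        (canonicalProgram.{u, v} f c).Computes f ∧
          (canonicalProgram.{u, v} f c).wsize s D = advPM s f := by
    intro X hX m c hXc
    have hc : ∀ x y : D, f x ≠ f y →
        ∑ j with x.1 j ≠ y.1 j, inner ℝ (c x j) (c y j) = 1 := fun x y hxy => by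
      simpa only [hXc x _ y _] using hX.1.sum_eq_one x y hxy
    have hP := computes_canonicalProgram.{u, v} hc
    -- Nonnegativity covers empty `D`, where the supremum takes the default value 0.
    refine ⟨hP, le_antisymm (Real.iSup_le (fun x => ?_) (advPM_nonneg s f))
      (hP.advPM_le_wsize hs)⟩
    refine (wsizeAt_canonicalProgram_le hc hs x).trans (le_trans (le_of_eq ?_)
      ((le_sdpObjective s X x).trans (hX.sdpObjective_le_advPM hs)))
    exact Finset.sum_congr rfl fun j _ => by rw [hXc, real_inner_self_eq_norm_sq]
  obtain ⟨X, hX⟩ := exists_isSDPOptimal hs f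
  obtain ⟨m, c, hc⟩ := exists_isCholesky hX.1.posSemidef
  refine ⟨⟨⟨_, build X hX m c hc⟩, ?_⟩, ⟨X, hX, m, c, hc⟩, fun X hX m c hc =>
    ⟨canonicalProgram f c, canonicalBasis f c, isCanonicalIn_canonicalProgram f c,
      isRealIn_canonicalProgram f c, isBuiltFrom_canonicalProgram f c, build X hX m c hc⟩⟩
  rintro _ ⟨P, hP, rfl⟩
  exact hP.advPM_le_wsize hs
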